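/- Let $a,b$ be real numbers with $a>-1$, $b>-1$, $a+b\ge-1$, and put $\varepsilon=\frac{a+b+1}{2}\ge 0$. For $N\ge1$ let $\mathrm{Sign}^+_N$ be the set of $N$-tuples of integers $\nu_1\ge\dots\ge\nu_N\ge0$. Let $P^{(a,b)}_n$ be the classical Jacobi polynomials (orthogonal with the weight $(1-x)^a(1+x)^b$ on $[-1,1]$), and for $\nu\in\mathrm{Sign}^+_N$ let $$P^{(a,b)}_{\nu,N}(x_1,\dots,x_N)=\frac{\det[P^{(a,b)}_{\nu_i+N-i}(x_j)]_{i,j=1}^N}{\prod_{1\le i<j\le N}(x_i-x_j)},\qquad \widetilde P^{(a,b)}_{\nu,N}(x_1,\dots,x_N)=\frac{P^{(a,b)}_{\nu,N}(x_1,\dots,x_N)}{P^{(a,b)}_{\nu,N}(1,\dots,1)}.$$ For integers $N>K\ge1$ the numbers $\Lambda^N_K(\nu,\kappa)$ ($\nu\in\mathrm{Sign}^+_N$, $\kappa\in\mathrm{Sign}^+_K$) are the coefficients of the (unique, finite) expansion $$\widetilde P^{(a,b)}_{\nu,N}(x_1,\dots,x_K,1,\dots,1)=\sum_{\kappa\in\mathrm{Sign}^+_K}\Lambda^N_K(\nu,\kappa)\,\widetilde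 P^{(a,b)}_{\kappa,K}(x_1,\dots,x_K).$$ Put $L=N-K+1$ and $$F_N(t;\nu;\varepsilon)=\prod_{i=1}^N\frac{t^2-(N-i+\varepsilon)^2}{t^2-(\nu_i+N-i+\varepsilon)^2},\qquad d_K(\kappa;\varepsilon)=\prod_{1\le i<j\le K}\frac{(\kappa_i+K-i+\varepsilon)^2-(\kappa_j+K-j+\varepsilon)^2}{(K-i+\varepsilon)^2-(K-j+\varepsilon)^2},$$ $$g_k(t)={}_4F_3\left[\begin{matrix}-k,\;k+2\varepsilon,\;L,\;L+a\\ -t+L+\varepsilon,\;t+L+\varepsilon,\;a+1\end{matrix}\,\Big|\,1\right]\ (k=0,1,2,\dots),\qquad G_{\kappa,K}(t_1,\dots,t_K)=\frac{\det[g_{\kappa_i+K-i}(t_j)]_{i,j=1}^K}{\det[g_{K-i}(t_j)]_{i,j=1}^K}.$$ **Theorem A.** Let $N>K\ge1$ and $\nu\in\mathrm{Sign}^+_N$. Then, as an identity of rational functions of the complex variables $t_1,\dots,t_K$, $$\prod_{j=1}^K F_N(t_j;\nu;\varepsilon)=\sum_{\kappa\in\mathrm{Sign}^+_K}\frac{\Lambda^N_K(\nu,\kappa)}{d_K(\kappa;\varepsilon)}\,G_{\kappa,K}(t_1,\dots,t_K).$$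 The sum on the right is finite, that is, $\Lambda^N_K(\nu,\kappa)\ne0$ for only finitely many $\kappa$, and the numbers $\Lambda^N_K(\nu,\kappa)$ are uniquely determined by this formula: if finitely supported complex coefficients $c(\kappa)$, $\kappa\in\mathrm{Sign}^+_K$, satisfy the identity in place of $\Lambda^N_K(\nu,\kappa)$, then $c(\kappa)=\Lambda^N_K(\nu,\kappa)$ for all $\kappa$. -/

import Mathlib

open Polynomial

/-- Positive signatures of length `N`: weakly decreasing `N`-tuples of nonnegative integers. -/
abbrev PosSignature (N : ℕ) : Type := {ν : Fin N → ℕ // Antitone ν}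

/-- The shifted coordinates `n_i = ν_i + N - i`, `1 ≤ i ≤ N`. With the index `i : Fin N` counted
from `0`, the number `N - i` of the one-based notation is `i.rev`. -/
def PosSignature.shifted {N : ℕ} (ν : PosSignature N) (i : Fin N) : ℕ := ν.1 i + (i.rev : ℕ)

/-- The product `∏_{i<j} (x_i - x_j)`. -/
def vandermondeProd {R : Type*} [CommRing R] {N : ℕ} (x : Fin N → R) : R :=
  ∏ i : Fin N, ∏ j ∈ Finset.Ioi i, (x i - x j)

/-- `∏_{i<j} (x_i - x_j)` divides `det [p_i(x_j)]` for arbitrary polynomials `p_i`. -/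
theorem vandermondeProd_dvd_det {R : Type*} [CommRing R] :
    ∀ {N : ℕ} (p : Fin N → R[X]) (x : Fin N → R),
      vandermondeProd x ∣ (Matrix.of fun i j : Fin N => (p i).eval (x j)).det := by
  intro N
  induction N with
  | zero => intro p x; simp [vandermondeProd]
  | succ n ih =>
    intro p x
    have hq : ∀ i, ∃ q : R[X], ∀ y, (p i).eval y = (y - x 0) * q.eval y + (p i).eval (x 0) := by
      intro i
      obtain ⟨q, hq⟩ := X_sub_C_dvd_sub_C_eval (a := x 0) (p := p i)
      refine ⟨q, fun y => ?_⟩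
      have h := congrArg (eval y) hq
      simp only [eval_sub, eval_C, eval_mul, eval_X] at h
      rw [← h]; ring
    choose q hq using hq
    rw [← Matrix.det_transpose]
    rw [Matrix.det_eq_of_forall_row_eq_smul_add_const
      (B := Matrix.of (Fin.cons (fun i => (p i).eval (x 0))
        (fun j i => (x j.succ - x 0) * (q i).eval (x j.succ))))
      (Fin.cons 0 fun _ => 1) 0 (by simp)
      (by
        intro j i
        refine Fin.cases ?_ (fun j => ?_) j
        · simp
        · simp [hq i (x j.succ)])]
    rw [Matrix.det_succ_row_zero]
    refine Finset.dvd_sum fun i _ => Dvd.dvd.mul_left ?_ _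
    have h2 : ((Matrix.of (Fin.cons (fun i => (p i).eval (x 0))
        (fun j i => (x j.succ - x 0) * (q i).eval (x j.succ)))
          : Matrix (Fin (n + 1)) (Fin (n + 1)) R).submatrix Fin.succ i.succAbove)
        = Matrix.of fun j k => (x (Fin.succ j) - x 0) *
            (Matrix.of fun k j : Fin n => (q (i.succAbove k)).eval (x j.succ)).transpose j k := by
      ext j k; simp
    rw [h2, Matrix.det_mul_column, Matrix.det_transpose]
    have h3 : vandermondeProd x =
        (∏ j : Fin n, (x 0 - x j.succ)) * vandermondeProd fun j : Fin n => x j.succ := by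
      unfold vandermondeProd
      rw [Fin.prod_univ_succ, Fin.prod_Ioi_zero]
      simp only [Fin.prod_Ioi_succ]
    rw [h3]
    refine mul_dvd_mul ?_ (ih _ _)
    exact Finset.prod_dvd_prod_of_dvd _ _ fun j _ => by
      rw [← neg_sub (x 0) (x j.succ)]; exact (dvd_neg).2 dvd_rfl

noncomputable section

/-- The bilinear form `∫_{-1}^{1} p(x) q(x) (1-x)^a (1+x)^b dx` on real polynomials. -/
def jacobiForm (a b : ℝ) (p q : ℝ[X]) : ℝ :=
  ∫ x in (-1 : ℝ)..1, p.eval x * q.eval x * ((1 - x) ^ a * (1 + x) ^ b)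

/-- The monic orthogonal polynomials with the weight `(1-x)^a (1+x)^b` on `[-1,1]`, obtained by
Gram-Schmidt orthogonalization of `1, X, X², …`. -/
def monicJacobi (a b : ℝ) : ℕ → ℝ[X]
  | n => X ^ n - ∑ k : Fin n,
      C (jacobiForm a b (X ^ n) (monicJacobi a b k) /
        jacobiForm a b (monicJacobi a b k) (monicJacobi a b k)) * monicJacobi a b k

/-- The classical Jacobi polynomial `P_n^{(a,b)}`: the orthogonal polynomial of degree `n` with the
weight `(1-x)^a (1+x)^b` on `[-1,1]`, in the usual normalization `P_n^{(a,b)}(1) = (a+1)_n / n!`. -/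
def jacobiPoly (a b : ℝ) (n : ℕ) : ℝ[X] :=
  C ((ascPochhammer ℝ n).eval (a + 1) / (n.factorial : ℝ) / (monicJacobi a b n).eval 1) *
    monicJacobi a b n

/-- The alternating polynomial `det [P_{ν_i+N-i}^{(a,b)}(x_j)]`. -/
def jacobiDet (a b : ℝ) {N : ℕ} (ν : PosSignature N) : MvPolynomial (Fin N) ℝ :=
  (Matrix.of fun i j : Fin N =>
    Polynomial.aeval (MvPolynomial.X j : MvPolynomial (Fin N) ℝ) (jacobiPoly a b (ν.shifted i))).det

theorem vandermondeProd_dvd_jacobiDet (a b : ℝ) {N : ℕ} (ν : PosSignature N) :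
    vandermondeProd (fun j : Fin N => (MvPolynomial.X j : MvPolynomial (Fin N) ℝ)) ∣
      jacobiDet a b ν := by
  have h := vandermondeProd_dvd_det
    (fun i : Fin N => (jacobiPoly a b (ν.shifted i)).map
      (algebraMap ℝ (MvPolynomial (Fin N) ℝ)))
    (fun j : Fin N => (MvPolynomial.X j : MvPolynomial (Fin N) ℝ))
  simpa only [jacobiDet, Polynomial.aeval_def, Polynomial.eval_map] using h

/-- The `N`-variate Jacobi polynomial `det [P_{ν_i+N-i}^{(a,b)}(x_j)] / ∏_{i<j} (x_i - x_j)`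
(the quotient of the exact division in the polynomial ring). -/
def jacobiMv (a b : ℝ) {N : ℕ} (ν : PosSignature N) : MvPolynomial (Fin N) ℝ :=
  (vandermondeProd_dvd_jacobiDet a b ν).choose

/-- The normalized `N`-variate Jacobi polynomial, with value `1` at `(1,…,1)`. -/
def jacobiMvNormalized (a b : ℝ) {N : ℕ} (ν : PosSignature N) : MvPolynomial (Fin N) ℝ :=
  MvPolynomial.C (MvPolynomial.eval (fun _ => (1 : ℝ)) (jacobiMv a b ν))⁻¹ * jacobiMv a b ν

/-- The specialization `p(x_1,…,x_K,1,…,1)` of a polynomial in `N` variables. -/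
def specializeOnes {N : ℕ} (K : ℕ) (p : MvPolynomial (Fin N) ℝ) : MvPolynomial (Fin K) ℝ :=
  MvPolynomial.aeval
    (fun i : Fin N => if h : (i : ℕ) < K then
      (MvPolynomial.X ⟨i, h⟩ : MvPolynomial (Fin K) ℝ) else 1) p

/-- `c` is the family of coefficients of a (finite) expansion of the normalized Jacobi polynomial
of `ν`, specialized at `(x_1,…,x_K,1,…,1)`, in the normalized `K`-variate Jacobi polynomials. -/
def IsJacobiExpansion (a b : ℝ) {N K : ℕ} (ν : PosSignature N) (c : PosSignature K → ℝ) : Prop :=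
  c.support.Finite ∧
    specializeOnes K (jacobiMvNormalized a b ν) =
      ∑ᶠ κ : PosSignature K, MvPolynomial.C (c κ) * jacobiMvNormalized a b κ

open Classical in
/-- The matrix `Λ^N_K`: its row at `ν` is the family of coefficients of the expansion of the
specialized normalized Jacobi polynomial of `ν`. -/
def jacobiLambda (a b : ℝ) {N K : ℕ} (ν : PosSignature N) : PosSignature K → ℝ :=
  if h : ∃ c : PosSignature K → ℝ, IsJacobiExpansion a b ν c then h.choose else 0

/-- The characteristic function `F_N(t; ν; ε) = ∏_i (t² - (N-i+ε)²) / (t² - (ν_i+N-i+ε)²)`. -/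
def sigCharFun {N : ℕ} (ε : ℝ) (ν : PosSignature N) (t : ℂ) : ℂ :=
  ∏ i : Fin N, (t ^ 2 - (((i.rev : ℕ) : ℂ) + (ε : ℂ)) ^ 2) /
    (t ^ 2 - ((ν.shifted i : ℂ) + (ε : ℂ)) ^ 2)

/-- `d_K(κ; ε) = ∏_{i<j} ((κ_i+K-i+ε)² - (κ_j+K-j+ε)²) / ((K-i+ε)² - (K-j+ε)²)`. -/
def sigDim {K : ℕ} (ε : ℝ) (κ : PosSignature K) : ℝ :=
  ∏ i : Fin K, ∏ j ∈ Finset.Ioi i,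
    (((κ.shifted i : ℝ) + ε) ^ 2 - ((κ.shifted j : ℝ) + ε) ^ 2) /
      ((((i.rev : ℕ) : ℝ) + ε) ^ 2 - (((j.rev : ℕ) : ℝ) + ε) ^ 2)

/-- The terminating series `₄F₃(-k, a₂, a₃, a₄; b₁, b₂, b₃; 1)`; the terms with index `m > k` of the
hypergeometric series vanish because of the factor `(-k)_m`. -/
def terminating4F3 (k : ℕ) (a₂ a₃ a₄ b₁ b₂ b₃ : ℂ) : ℂ :=
  ∑ m ∈ Finset.range (k + 1),
    ((ascPochhammer ℂ m).eval (-(k : ℂ)) * (ascPochhammer ℂ m).eval a₂ *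
        (ascPochhammer ℂ m).eval a₃ * (ascPochhammer ℂ m).eval a₄) /
      ((ascPochhammer ℂ m).eval b₁ * (ascPochhammer ℂ m).eval b₂ *
        (ascPochhammer ℂ m).eval b₃ * (m.factorial : ℂ))

/-- `g_k(t; a, ε, L) = ₄F₃(-k, k+2ε, L, L+a; -t+L+ε, t+L+ε, a+1; 1)`. -/
def gFun (a ε : ℝ) (L k : ℕ) (t : ℂ) : ℂ :=
  terminating4F3 k ((k : ℂ) + 2 * (ε : ℂ)) (L : ℂ) ((L : ℂ) + (a : ℂ))
    (-t + (L : ℂ) + (ε : ℂ)) (t + (L : ℂ) + (ε : ℂ)) ((a : ℂ) + 1)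

/-- The Schur-type function `G_{κ,K}(t_1,…,t_K) = det[g_{κ_i+K-i}(t_j)] / det[g_{K-i}(t_j)]`. -/
def schurG (a ε : ℝ) (L : ℕ) {K : ℕ} (κ : PosSignature K) (t : Fin K → ℂ) : ℂ :=
  (Matrix.of fun i j : Fin K => gFun a ε L (κ.shifted i) (t j)).det /
    (Matrix.of fun i j : Fin K => gFun a ε L (i.rev : ℕ) (t j)).det

/-- The points `t ∈ ℂ^K` at which all the rational expressions are defined: no `t_j` is a zero of a
denominator of `F_N(·; ν; ε)` or of some `g_k` (these are the points `±(L+ε+m)`, `m ≥ 0`), and the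
numbers `t_j²` are pairwise distinct. -/
def IsRegularPoint {N K : ℕ} (ε : ℝ) (L : ℕ) (ν : PosSignature N) (t : Fin K → ℂ) : Prop :=
  (∀ j, ∀ i : Fin N, t j ^ 2 ≠ ((ν.shifted i : ℂ) + (ε : ℂ)) ^ 2) ∧
  (∀ j, ∀ m : ℕ, t j ^ 2 ≠ ((L : ℂ) + (ε : ℂ) + (m : ℂ)) ^ 2) ∧
  Function.Injective fun j => t j ^ 2

end

/-! In the variables `y = (1 - x) / 2` the Jacobi polynomial of degree `n` is a multiple of `Q_n(y)
= ∑_m c_m N_m(u_n) y^m`. Here `u_n = (n + ε)²`, `N_m(u) = ∏_{l<m} (u - u_l)` and `c_m = (-1)^m /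
((a+1)_m m!)`. The degree enters only through Newton products at the nodes `u_n`, which are distinct
because `ε ≥ 0`. The point `x = 1` becomes `y = 0`.

Write `N = K + M`, so that `L = M + 1`. A product functional `∏ y_j^{e_j} ↦ ∏ φ_j(e_j)` sends a
determinant `det [p_i(y_j)]` to a determinant of numbers. Setting the last `M` variables to zero can
be done on this side: the first `K` functionals are shifted by `M`, and `M` functionals extracting
the coefficients of `1, y, …, y^{M-1}` are added (`mvFunctional_specializeZeros`). Thus every choice
of the `φ_j` turns the expansion that defines `Λ` into an identity between one `N × N` determinant
and a combination of `K × K` determinants (`det_extendFunctional_hypPoly`).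

The functional is chosen as `φ(e) = c_{M+e}⁻¹ ∏_{l<e} (T - u_{M+1+l})⁻¹` with `T = t²`. It sends
`Q_k` to a constant multiple of `g_k(t)`. Its shift by `M` sends `Q_n` to `(T - u_M) N_M(u_n) / (T -
u_n)`, by a telescoping sum. The `N × N` determinant therefore becomes a mixed Cauchy-Vandermonde
determinant with a product formula (`exists_cauchyVandermonde`). Together with the product formula
for `det [g_{K-i}(t_j)]` (`det_sum_prod_inv`) this gives `∏ F_N(t_j)` up to a constant independent
of `ν`. The constant is found from `ν = 0`, where both sides are explicit.

For uniqueness, `g_k` is triangular in the functions `∏_{l<m} (T - u_{M+1+l})⁻¹`, so any finite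
number of the `g_k` is separated by points. Then the determinants `det [g_{κ_i+K-i}(t_j)]` are
linearly independent (`eq_zero_of_sum_det_eq_zero`). The same principle with `Q_k` gives uniqueness
of the Jacobi expansion itself; its existence follows by antisymmetrization. -/

noncomputable section

/-! ### Product functionals and specialization of variables to zero -/

/-- The linear functional on polynomials that sends `X ^ m` to `φ m`. -/
def polyFunctional (R : Type*) {A : Type*} [CommRing R] [CommRing A] [Algebra R A] (φ : ℕ → A) :
    R[X] →ₗ[R] A :=
  Polynomial.lsum fun m => LinearMap.toSpanSingleton R A (φ m)

/-- The product functional on polynomials in `n` variables: it sends `∏ X_j ^ e_j` to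
`∏ φ_j(e_j)`. -/
def mvFunctional (R : Type*) {A : Type*} [CommRing R] [CommRing A] [Algebra R A] {n : ℕ}
    (φ : Fin n → ℕ → A) : MvPolynomial (Fin n) R →ₗ[R] A :=
  (MvPolynomial.basisMonomials (Fin n) R).constr R fun e => ∏ j, φ j (e j)

section functional

variable {R A : Type*} [CommRing R] [CommRing A] [Algebra R A] {n : ℕ}

theorem polyFunctional_eq_sum_range (φ : ℕ → A) (p : R[X]) {D : ℕ} (hD : p.natDegree < D) :
    polyFunctional R φ p = ∑ m ∈ Finset.range D, p.coeff m • φ m := by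
  simp only [polyFunctional, Polynomial.lsum_apply, LinearMap.toSpanSingleton_apply]
  exact p.sum_over_range' (fun m => by simp) D hD

theorem mvFunctional_monomial (φ : Fin n → ℕ → A) (e : Fin n →₀ ℕ) (c : R) :
    mvFunctional R φ (MvPolynomial.monomial e c) = c • ∏ j, φ j (e j) := by
  have h : MvPolynomial.monomial e c = c • MvPolynomial.basisMonomials (Fin n) R e := by
    simp [MvPolynomial.smul_monomial]
  rw [h, map_smul, mvFunctional, Module.Basis.constr_basis]

theorem prod_aeval_X_eq_sum (p : Fin n → R[X]) (D : ℕ) (hD : ∀ j, (p j).natDegree < D) :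
    ∏ j, Polynomial.aeval (MvPolynomial.X j : MvPolynomial (Fin n) R) (p j) =
      ∑ e ∈ Fintype.piFinset fun _ : Fin n => Finset.range D,
        MvPolynomial.monomial (Finsupp.equivFunOnFinite.symm e) (∏ j, (p j).coeff (e j)) := by
  have h1 : ∀ j, Polynomial.aeval (MvPolynomial.X j : MvPolynomial (Fin n) R) (p j) =
      ∑ m ∈ Finset.range D, MvPolynomial.C ((p j).coeff m) * MvPolynomial.X j ^ m := by
    intro j
    rw [Polynomial.aeval_eq_sum_range' (hD j)]
    simp [MvPolynomial.smul_eq_C_mul]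
  simp_rw [h1]
  rw [Finset.prod_univ_sum]
  refine Finset.sum_congr rfl fun e _ => ?_
  rw [Finset.prod_mul_distrib, MvPolynomial.monomial_eq, map_prod]
  congr 1
  rw [Finsupp.prod_fintype _ _ (by simp)]
  simp

theorem mvFunctional_prod_aeval (φ : Fin n → ℕ → A) (p : Fin n → R[X]) :
    mvFunctional R φ (∏ j, Polynomial.aeval (MvPolynomial.X j : MvPolynomial (Fin n) R) (p j)) =
      ∏ j, polyFunctional R (φ j) (p j) := by
  have hD : ∀ j, (p j).natDegree < (∑ j, (p j).natDegree) + 1 := fun j =>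
    Nat.lt_succ_of_le (Finset.single_le_sum (f := fun j => (p j).natDegree)
      (fun _ _ => Nat.zero_le _) (Finset.mem_univ j))
  rw [prod_aeval_X_eq_sum p _ hD, map_sum]
  simp_rw [polyFunctional_eq_sum_range (φ _) (p _) (hD _)]
  rw [Finset.prod_univ_sum]
  refine Finset.sum_congr rfl fun e _ => ?_
  rw [mvFunctional_monomial]
  simp [Algebra.smul_def, Finset.prod_mul_distrib]

/-- Each Leibniz term is a product of one-variable polynomials in distinct variables, on which the
functional factors. -/
theorem mvFunctional_det (φ : Fin n → ℕ → A) (p : Fin n → Fin n → R[X]) :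
    mvFunctional R φ (Matrix.of fun i j : Fin n =>
        Polynomial.aeval (MvPolynomial.X j : MvPolynomial (Fin n) R) (p i j)).det =
      (Matrix.of fun i j : Fin n => polyFunctional R (φ j) (p i j)).det := by
  rw [Matrix.det_apply, Matrix.det_apply, map_sum]
  refine Finset.sum_congr rfl fun σ _ => ?_
  rw [Units.smul_def, Units.smul_def, map_zsmul]
  congr 1
  simpa using mvFunctional_prod_aeval φ fun j => p (σ j) j

theorem polyFunctional_X_pow (φ : ℕ → A) (m : ℕ) : polyFunctional R φ (X ^ m) = φ m := by
  rw [polyFunctional, Polynomial.lsum_apply, Polynomial.X_pow_eq_monomial,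
    Polynomial.sum_monomial_index] <;> simp

/-- The determinant `det [X_j ^ i] = ∏_{i<j} (X_j - X_i)` in `n` variables. -/
def mvVandermonde (R : Type*) [CommRing R] (n : ℕ) : MvPolynomial (Fin n) R :=
  (Matrix.of fun i j : Fin n => (MvPolynomial.X j : MvPolynomial (Fin n) R) ^ (i : ℕ)).det

theorem mvVandermonde_eq (n : ℕ) : mvVandermonde R n =
    ∏ i : Fin n, ∏ j ∈ Finset.Ioi i, (MvPolynomial.X j - MvPolynomial.X i) := by
  rw [← Matrix.det_vandermonde, mvVandermonde, ← Matrix.det_transpose]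
  rfl

theorem mvVandermonde_ne_zero [IsDomain R] (n : ℕ) : mvVandermonde R n ≠ 0 := by
  rw [mvVandermonde_eq, ← Matrix.det_vandermonde, Matrix.det_vandermonde_ne_zero_iff]
  exact MvPolynomial.X_injective

theorem mvFunctional_mvVandermonde_mul_monomial (φ : Fin n → ℕ → A) (e : Fin n →₀ ℕ) :
    mvFunctional R φ (mvVandermonde R n * MvPolynomial.monomial e 1) =
      (Matrix.of fun i j : Fin n => φ j (e j + i)).det := by
  have h : mvVandermonde R n * MvPolynomial.monomial e 1 =
      (Matrix.of fun i j : Fin n => Polynomial.aeval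
        (MvPolynomial.X j : MvPolynomial (Fin n) R) ((X : R[X]) ^ (e j + (i : ℕ)))).det := by
    rw [MvPolynomial.monomial_eq, Finsupp.prod_fintype _ _ (by simp), map_one, one_mul, mul_comm,
      mvVandermonde, ← Matrix.det_mul_row]
    congr 1
    ext1 i j
    simp [pow_add]
  rw [h, mvFunctional_det]
  simp only [polyFunctional_X_pow]

/-- The row arrangement of the block decomposition: the last `K` rows come first. -/
def rowBlocks (K M : ℕ) : Fin K ⊕ Fin M ≃ Fin (K + M) :=
  (Equiv.sumComm _ _).trans (finSumFinEquiv.trans (finCongr (add_comm M K)))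

theorem rowBlocks_inl {K M : ℕ} (i : Fin K) :
    ((rowBlocks K M (Sum.inl i) : Fin _) : ℕ) = M + i := by
  simp [rowBlocks, add_comm]

theorem rowBlocks_inr {K M : ℕ} (i : Fin M) : ((rowBlocks K M (Sum.inr i) : Fin _) : ℕ) = i := by
  simp [rowBlocks]

/-- The sign that relates the arrangement of rows in `rowBlocks` to the order of the columns. -/
def blockSign (K M : ℕ) : ℤˣ :=
  Equiv.Perm.sign ((rowBlocks K M).symm.trans finSumFinEquiv)

theorem det_submatrix_rowBlocks {K M : ℕ} (B : Matrix (Fin (K + M)) (Fin (K + M)) A) :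
    (B.submatrix (rowBlocks K M) finSumFinEquiv).det = ((blockSign K M : ℤ) : A) * B.det := by
  rw [blockSign, ← Matrix.det_permute', ← Matrix.det_submatrix_equiv_self (rowBlocks K M)
    (B.submatrix id _)]
  congr 1
  ext i j
  simp

/-- Shifts the functionals `φ_j` by `M` and adds the functionals that extract the coefficients of
`1, X, …, X^{M-1}`. -/
def extendFunctional {K : ℕ} (M : ℕ) (φ : Fin K → ℕ → A) : Fin (K + M) → ℕ → A :=
  Fin.append (fun j e => if M ≤ e then φ j (e - M) else 0)
    (fun m e => if e = (m : ℕ) then 1 else 0)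

/-- The specialization `p(X_1,…,X_K,0,…,0)`. -/
def specializeZeros (R : Type*) [CommRing R] (K M : ℕ) :
    MvPolynomial (Fin (K + M)) R →ₐ[R] MvPolynomial (Fin K) R :=
  MvPolynomial.aeval (Fin.append MvPolynomial.X fun _ => 0)

/-- Take the least `m` whose trailing exponent `e_m` is nonzero. If `e_m > m`, its column vanishes.
Otherwise it equals the column of `m - e_m`, whose exponent is zero by minimality. -/
theorem det_extendFunctional_eq_zero {K M : ℕ} (φ : Fin K → ℕ → A) (e : Fin (K + M) → ℕ)
    (he : ∃ m : Fin M, e (Fin.natAdd K m) ≠ 0) :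
    (Matrix.of fun i j : Fin (K + M) => extendFunctional M φ j (e j + i)).det = 0 := by
  obtain ⟨m, hm, hmin⟩ := WellFounded.has_min (wellFounded_lt (α := Fin M))
    {m : Fin M | e (Fin.natAdd K m) ≠ 0} he
  by_cases hlt : (m : ℕ) < e (Fin.natAdd K m)
  · refine Matrix.det_eq_zero_of_column_eq_zero (Fin.natAdd K m) fun i => ?_
    simp only [Matrix.of_apply, extendFunctional, Fin.append_right]
    rw [if_neg (by omega)]
  · have hm0 : e (Fin.natAdd K m) ≠ 0 := hm
    let m' : Fin M := ⟨m - e (Fin.natAdd K m), by omega⟩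
    have hm' : e (Fin.natAdd K m') = 0 := by
      by_contra h
      refine hmin m' h ?_
      rw [Fin.lt_def]
      change (m : ℕ) - e (Fin.natAdd K m) < m
      omega
    refine Matrix.det_zero_of_column_eq (i := Fin.natAdd K m) (j := Fin.natAdd K m') ?_ fun i => ?_
    · intro h
      have h2 : (m : ℕ) = m' := by simpa [Fin.ext_iff] using h
      change (m : ℕ) = (m : ℕ) - e (Fin.natAdd K m) at h2
      omega
    · simp only [Matrix.of_apply, extendFunctional, Fin.append_right, hm']
      congr 1
      simp only [m', eq_iff_iff]
      omega

/-- With zero trailing exponents the last `M` columns are unit vectors supported in the first `M`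
rows. Moving the last `K` rows to the top makes the matrix block lower triangular with an identity
block, and in the top rows the shift by `M` cancels. -/
theorem det_extendFunctional {K M : ℕ} (φ : Fin K → ℕ → A) (e : Fin (K + M) → ℕ)
    (he : ∀ m : Fin M, e (Fin.natAdd K m) = 0) :
    ((blockSign K M : ℤ) : A) *
      (Matrix.of fun i j : Fin (K + M) => extendFunctional M φ j (e j + i)).det =
    (Matrix.of fun i j : Fin K => φ j (e (Fin.castAdd M j) + i)).det := by
  rw [← det_submatrix_rowBlocks]
  have h : (Matrix.of fun i j : Fin (K + M) => extendFunctional M φ j (e j + i)).submatrix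
      (rowBlocks K M) finSumFinEquiv = Matrix.fromBlocks
        (Matrix.of fun i j : Fin K => φ j (e (Fin.castAdd M j) + i)) 0
        (Matrix.of fun (i : Fin M) (j : Fin K) => if M ≤ e (Fin.castAdd M j) + i then
          φ j (e (Fin.castAdd M j) + i - M) else 0) 1 := by
    ext (i | i) (j | j)
    · simp only [Matrix.submatrix_apply, finSumFinEquiv_apply_left, Matrix.of_apply,
        extendFunctional, Fin.append_left, Matrix.fromBlocks_apply₁₁, rowBlocks_inl]
      rw [if_pos (by omega)]
      congr 1
      omega
    · simp only [Matrix.submatrix_apply, finSumFinEquiv_apply_right, Matrix.of_apply,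
        extendFunctional, Fin.append_right, Matrix.fromBlocks_apply₁₂, rowBlocks_inl, he]
      rw [if_neg (by omega)]
      rfl
    · simp only [Matrix.submatrix_apply, finSumFinEquiv_apply_left, Matrix.of_apply,
        extendFunctional, Fin.append_left, Matrix.fromBlocks_apply₂₁, rowBlocks_inr]
    · simp only [Matrix.submatrix_apply, finSumFinEquiv_apply_right, Matrix.of_apply,
        extendFunctional, Fin.append_right, Matrix.fromBlocks_apply₂₂, rowBlocks_inr, he,
        Matrix.one_apply, zero_add, Fin.ext_iff]
  rw [h, Matrix.det_fromBlocks_zero₁₂, Matrix.det_one, mul_one]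

/-- By linearity it suffices to test monomials. Those containing one of the last `M` variables are
killed on both sides, and the others reduce to a `K × K` determinant. -/
theorem mvFunctional_specializeZeros {K M : ℕ} (φ : Fin K → ℕ → A)
    (P : MvPolynomial (Fin (K + M)) R) :
    ((blockSign K M : ℤ) : A) *
        mvFunctional R (extendFunctional M φ) (mvVandermonde R (K + M) * P) =
      mvFunctional R φ (mvVandermonde R K * specializeZeros R K M P) := by
  induction P using MvPolynomial.induction_on' with
  | add p q hp hq => simp only [mul_add, map_add, hp, hq]
  | monomial e c =>
    have hc : MvPolynomial.monomial e c = c • MvPolynomial.monomial e (1 : R) := by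
      simp [MvPolynomial.smul_monomial]
    rw [hc]
    simp only [map_smul, mul_smul_comm]
    congr 1
    rw [mvFunctional_mvVandermonde_mul_monomial]
    have hs : specializeZeros R K M (MvPolynomial.monomial e 1) =
        (∏ j : Fin K, MvPolynomial.X j ^ e (Fin.castAdd M j)) *
          ∏ m : Fin M, 0 ^ e (Fin.natAdd K m) := by
      rw [specializeZeros, MvPolynomial.aeval_monomial, map_one, one_mul,
        Finsupp.prod_fintype _ _ (by simp), Fin.prod_univ_add]
      simp
    by_cases he : ∃ m : Fin M, e (Fin.natAdd K m) ≠ 0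
    · rw [det_extendFunctional_eq_zero φ e he, hs]
      obtain ⟨m, hm⟩ := he
      rw [Finset.prod_eq_zero (Finset.mem_univ m) (zero_pow hm)]
      simp
    · push Not at he
      rw [det_extendFunctional φ e he, hs]
      have h1 : (∏ j : Fin K, (MvPolynomial.X j : MvPolynomial (Fin K) R) ^ e (Fin.castAdd M j)) *
          ∏ m : Fin M, 0 ^ e (Fin.natAdd K m) =
          MvPolynomial.monomial (Finsupp.equivFunOnFinite.symm fun j : Fin K =>
            e (Fin.castAdd M j)) 1 := by
        rw [MvPolynomial.monomial_eq, Finsupp.prod_fintype _ _ (by simp)]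
        simp [he]
      rw [h1, mvFunctional_mvVandermonde_mul_monomial]
      simp

end functional

/-! ### Signatures as strictly decreasing sequences -/

namespace PosSignature

variable {K : ℕ}

theorem shifted_strictAnti (κ : PosSignature K) : StrictAnti κ.shifted := by
  intro i j hij
  have h1 := κ.2 hij.le
  have h2 : (j.rev : ℕ) < i.rev := Fin.lt_def.1 (Fin.rev_lt_rev.2 hij)
  simp only [shifted]
  omega

theorem shifted_injective : Function.Injective (shifted : PosSignature K → Fin K → ℕ) := by
  intro κ μ h
  ext i
  have := congrFun h i
  simpa [shifted] using this

/-- A strictly decreasing sequence of naturals drops by at least one at each step, so it dominates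
the staircase `i.rev`, which can be subtracted. -/
theorem exists_shifted_eq {k : Fin K → ℕ} (hk : StrictAnti k) :
    ∃ κ : PosSignature K, κ.shifted = k := by
  have h2 : ∀ n : ℕ, ∀ i j : Fin K, (j : ℕ) = i + n → k j + n ≤ k i := by
    intro n
    induction n with
    | zero => intro i j h; have : j = i := Fin.ext h; simp [this]
    | succ n ih =>
      intro i j h
      have h3 := ih i ⟨i + n, by omega⟩ rfl
      have h4 : k j < k ⟨i + n, by omega⟩ := hk (by rw [Fin.lt_def]; simp; omega)
      omega
  have h1 : ∀ i, (i.rev : ℕ) ≤ k i := by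
    intro i
    have hi := i.2
    have := h2 i.rev i ⟨K - 1, by omega⟩ (by simp only [Fin.val_rev]; omega)
    omega
  refine ⟨⟨fun i => k i - i.rev, fun i j hij => ?_⟩, ?_⟩
  · have := h2 (j - i) i j (by have := Fin.le_def.1 hij; omega)
    have h5 := h1 j
    have h6 := h1 i
    have h7 := Fin.le_def.1 hij
    simp only [Fin.val_rev] at *
    omega
  · ext i
    have := h1 i
    simp only [shifted]
    omega

/-- The zero signature. -/
instance : Zero (PosSignature K) := ⟨⟨0, fun _ _ _ => le_rfl⟩⟩

theorem zero_shifted (i : Fin K) : (0 : PosSignature K).shifted i = i.rev := by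
  change 0 + (i.rev : ℕ) = i.rev
  simp

/-- If every value of `μ.shifted` occurs in `κ.shifted`, the matching of positions is strictly
increasing on `Fin K`, hence the identity. So for `κ ≠ μ` some value is missing and its column is
zero. -/
theorem det_ite_shifted {F : Type*} [CommRing F] [DecidableEq (PosSignature K)]
    (κ μ : PosSignature K) :
    (Matrix.of fun i j : Fin K => if μ.shifted j = κ.shifted i then (1 : F) else 0).det =
      if κ = μ then 1 else 0 := by
  split_ifs with h
  · subst h
    convert Matrix.det_one (n := Fin K) (R := F)
    ext i j
    simp [Matrix.one_apply, κ.shifted_strictAnti.injective.eq_iff, eq_comm]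
  · by_cases hr : ∀ j, ∃ i, κ.shifted i = μ.shifted j
    · exfalso
      apply h
      apply shifted_injective
      choose f hf using hr
      have hmono : StrictMono f := by
        intro i j hij
        have := μ.shifted_strictAnti hij
        rw [← hf, ← hf] at this
        exact κ.shifted_strictAnti.lt_iff_gt.1 this
      have hid : f = id := by
        have hsurj : Function.Surjective f := Finite.surjective_of_injective hmono.injective
        exact (hmono.range_inj strictMono_id).1 (by rw [hsurj.range_eq, Set.range_id])
      ext i
      have := hf i
      simpa [hid] using this
    · push Not at hr
      obtain ⟨j, hj⟩ := hr
      exact Matrix.det_eq_zero_of_column_eq_zero j fun i => by simp [(hj i).symm]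

end PosSignature

/-! ### Linear independence and spanning for determinants -/

/-- If the functions `f_0, …, f_{R-1}` are separated by `R` points for every `R`, then the
determinants `det [f_{κ_i+K-i}(x_j)]` are linearly independent. -/
theorem eq_zero_of_sum_det_eq_zero {F S : Type*} [Field F] {K : ℕ} (f : ℕ → S → F)
    (hf : ∀ R, ∃ s : Fin R → S, (Matrix.of fun i j : Fin R => f i (s j)).det ≠ 0)
    (s : Finset (PosSignature K)) (c : PosSignature K → F)
    (h : ∀ x : Fin K → S,
      ∑ κ ∈ s, c κ * (Matrix.of fun i j : Fin K => f (κ.shifted i) (x j)).det = 0) :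
    ∀ κ ∈ s, c κ = 0 := by
  classical
  intro μ hμ
  -- `R` exceeds every shifted part that occurs, so all the rows involved are rows of a single `R ×
  -- R` matrix.
  set R := (∑ κ ∈ s, ∑ i, κ.shifted i) + 1 with hR
  have hbound : ∀ κ ∈ s, ∀ i, κ.shifted i < R := fun κ hκ i => Nat.lt_succ_of_le <|
    (Finset.single_le_sum (f := fun i => κ.shifted i) (fun _ _ => Nat.zero_le _)
      (Finset.mem_univ i)).trans
    (Finset.single_le_sum (f := fun κ : PosSignature K => ∑ i, κ.shifted i)
      (fun _ _ => Nat.zero_le _) hκ)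
  obtain ⟨p, hp⟩ := hf R
  set B := (Matrix.of fun i j : Fin R => f i (p j)) with hB
  have hBB : B * B⁻¹ = 1 := Matrix.mul_nonsing_inv _ (isUnit_iff_ne_zero.2 hp)
  let m : Fin K → Fin R := fun j => ⟨μ.shifted j, hbound μ hμ j⟩
  -- The columns of `B⁻¹` are combinations of point evaluations dual to the `f i`. Applying the one
  -- dual to `f (μ.shifted j)` in the variable `x j`, and expanding multilinearly, isolates the
  -- coefficient of `μ`.
  have key : ∀ κ ∈ s, (if κ = μ then (1 : F) else 0) =
      ∑ l : Fin K → Fin R, (∏ j, B⁻¹ (l j) (m j)) *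
        (Matrix.of fun i j : Fin K => f (κ.shifted i) (p (l j))).det := by
    intro κ hκ
    rw [← PosSignature.det_ite_shifted κ μ, ← Matrix.det_transpose]
    have h1 : (Matrix.of fun i j : Fin K =>
        if μ.shifted j = κ.shifted i then (1 : F) else 0).transpose =
        fun j => ∑ l : Fin R, B⁻¹ l (m j) • fun i => f (κ.shifted i) (p l) := by
      ext j i
      have h2 := congrFun (congrFun hBB ⟨κ.shifted i, hbound κ hκ i⟩) (m j)
      rw [Matrix.mul_apply, Matrix.one_apply] at h2
      simp only [Matrix.transpose_apply, Matrix.of_apply, Finset.sum_apply, Pi.smul_apply,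
        smul_eq_mul]
      simp only [m, Fin.mk.injEq] at h2
      simp only [eq_comm (a := μ.shifted j), m]
      rw [← h2]
      exact Finset.sum_congr rfl fun l _ => by rw [hB, Matrix.of_apply, mul_comm]
    have h3 := (Matrix.detRowAlternating (n := Fin K) (R := F)).toMultilinearMap.map_sum
      (fun (j : Fin K) (l : Fin R) => B⁻¹ l (m j) • fun i => f (κ.shifted i) (p l))
    rw [h1]
    refine Eq.trans h3 (Finset.sum_congr rfl fun l _ => ?_)
    rw [MultilinearMap.map_smul_univ, smul_eq_mul]
    congr 1
    rw [← Matrix.det_transpose]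
    rfl
  have h0 : ∑ κ ∈ s, c κ * (if κ = μ then (1 : F) else 0) = 0 := by
    rw [Finset.sum_congr rfl fun κ hκ => by rw [key κ hκ]]
    simp_rw [Finset.mul_sum]
    rw [Finset.sum_comm]
    refine Finset.sum_eq_zero fun l _ => ?_
    rw [← mul_zero (∏ j, B⁻¹ (l j) (m j)), ← h fun j => p (l j), Finset.mul_sum]
    exact Finset.sum_congr rfl fun κ _ => by ring
  simpa [hμ] using h0

/-- The polynomial `det [q_{k_i}(X_j)]` in `n` variables. -/
def mvDet {R : Type*} [CommRing R] {n : ℕ} (q : ℕ → R[X]) (k : Fin n → ℕ) :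
    MvPolynomial (Fin n) R :=
  (Matrix.of fun i j : Fin n =>
    Polynomial.aeval (MvPolynomial.X j : MvPolynomial (Fin n) R) (q (k i))).det

theorem rename_det_aeval {R : Type*} [CommRing R] {n : ℕ} (p : Fin n → R[X])
    (σ : Equiv.Perm (Fin n)) :
    MvPolynomial.rename σ (Matrix.of fun i j : Fin n =>
      Polynomial.aeval (MvPolynomial.X j : MvPolynomial (Fin n) R) (p i)).det =
    ((Equiv.Perm.sign σ : ℤ) : MvPolynomial (Fin n) R) * (Matrix.of fun i j : Fin n =>
      Polynomial.aeval (MvPolynomial.X j : MvPolynomial (Fin n) R) (p i)).det := by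
  rw [← Matrix.det_permute', AlgHom.map_det]
  congr 1
  ext1 i j
  simp [← Polynomial.aeval_algHom_apply]

theorem rename_mvVandermonde {R : Type*} [CommRing R] {n : ℕ} (σ : Equiv.Perm (Fin n)) :
    MvPolynomial.rename σ (mvVandermonde R n) =
      ((Equiv.Perm.sign σ : ℤ) : MvPolynomial (Fin n) R) * mvVandermonde R n := by
  simpa [mvVandermonde] using rename_det_aeval (R := R) (fun i : Fin n => X ^ (i : ℕ)) σ

/-- Distinct indices can be sorted into decreasing order at the cost of a sign; repeated indices
give determinant zero. -/
theorem mvDet_mem_span {R : Type*} [CommRing R] {n : ℕ} (q : ℕ → R[X]) (k : Fin n → ℕ) :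
    mvDet q k ∈ Submodule.span R
      (Set.range fun κ : PosSignature n => mvDet q κ.shifted) := by
  by_cases hk : Function.Injective k
  · let σ : Equiv.Perm (Fin n) := Fin.revPerm.trans (Tuple.sort k)
    have hanti : StrictAnti (k ∘ σ) := by
      have hmono : StrictMono (k ∘ Tuple.sort k) :=
        (Tuple.monotone_sort k).strictMono_of_injective (hk.comp (Tuple.sort k).injective)
      intro i j hij
      exact hmono (Fin.rev_lt_rev.2 hij)
    obtain ⟨κ, hκ⟩ := PosSignature.exists_shifted_eq hanti
    have h : mvDet q κ.shifted = ((Equiv.Perm.sign σ : ℤ) : MvPolynomial (Fin n) R) * mvDet q k := by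
      rw [mvDet, mvDet, ← Matrix.det_permute, hκ]
      rfl
    have h2 : mvDet q k = (Equiv.Perm.sign σ : ℤ) • mvDet q κ.shifted := by
      rw [h, zsmul_eq_mul, ← mul_assoc, ← Int.cast_mul]
      simp [← Units.val_mul]
    rw [h2]
    exact zsmul_mem (Submodule.subset_span (Set.mem_range_self κ)) _
  · rw [Function.Injective] at hk
    push Not at hk
    obtain ⟨i, j, hij, hne⟩ := hk
    have : mvDet q k = 0 := Matrix.det_zero_of_row_eq hne (by ext; simp [hij])
    rw [this]
    exact zero_mem _

/-- `det [r_i(X_j)]` as a multilinear function of the polynomials `r_i`. -/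
def detMultilinear (R : Type*) [CommRing R] (n : ℕ) :
    MultilinearMap R (fun _ : Fin n => R[X]) (MvPolynomial (Fin n) R) :=
  ((Matrix.detRowAlternating (n := Fin n)
    (R := MvPolynomial (Fin n) R)).toMultilinearMap.restrictScalars R).compLinearMap
    fun _ => LinearMap.pi fun j => (Polynomial.aeval (MvPolynomial.X j)).toLinearMap

theorem detMultilinear_apply {R : Type*} [CommRing R] {n : ℕ} (r : Fin n → R[X]) :
    detMultilinear R n r = (Matrix.of fun i j : Fin n =>
      Polynomial.aeval (MvPolynomial.X j : MvPolynomial (Fin n) R) (r i)).det := rfl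

theorem det_aeval_mem_span {R : Type*} [CommRing R] {n : ℕ} (q : ℕ → R[X])
    (hq : Submodule.span R (Set.range q) = ⊤) (r : Fin n → R[X]) :
    (Matrix.of fun i j : Fin n =>
      Polynomial.aeval (MvPolynomial.X j : MvPolynomial (Fin n) R) (r i)).det ∈
    Submodule.span R (Set.range fun κ : PosSignature n => mvDet q κ.shifted) := by
  have h1 : ∀ i, ∃ c : ℕ →₀ R, r i = ∑ k ∈ c.support, c k • q k := by
    intro i
    have : r i ∈ Submodule.span R (Set.range q) := by rw [hq]; trivial
    obtain ⟨c, hc⟩ := Finsupp.mem_span_range_iff_exists_finsupp.1 this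
    exact ⟨c, hc.symm⟩
  choose c hc using h1
  have h2 : r = fun i => ∑ k ∈ (c i).support, c i k • q k := funext hc
  rw [← detMultilinear_apply, h2, MultilinearMap.map_sum_finset]
  refine Submodule.sum_mem _ fun k _ => ?_
  rw [MultilinearMap.map_smul_univ]
  exact Submodule.smul_mem _ _ (mvDet_mem_span q k)

/-- An alternating polynomial is a linear combination of the determinants `det [q_{κ_i+n-i}(X_j)]`
when the `q_k` span the polynomials in one variable. -/
theorem alternating_mem_span {R : Type*} [Field R] [CharZero R] {n : ℕ} (q : ℕ → R[X])
    (hq : Submodule.span R (Set.range q) = ⊤) (W : MvPolynomial (Fin n) R)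
    (hW : ∀ σ : Equiv.Perm (Fin n), MvPolynomial.rename σ W =
      ((Equiv.Perm.sign σ : ℤ) : MvPolynomial (Fin n) R) * W) :
    W ∈ Submodule.span R (Set.range fun κ : PosSignature n => mvDet q κ.shifted) := by
  -- Antisymmetrization: it sends each monomial to a determinant of powers and multiplies `W` by
  -- `n!`, which is invertible in characteristic zero.
  let A : MvPolynomial (Fin n) R →ₗ[R] MvPolynomial (Fin n) R :=
    ∑ σ : Equiv.Perm (Fin n), (Equiv.Perm.sign σ : ℤ) • (MvPolynomial.rename σ).toLinearMap
  have hA : ∀ P, A P ∈ Submodule.span R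
      (Set.range fun κ : PosSignature n => mvDet q κ.shifted) := by
    intro P
    induction P using MvPolynomial.induction_on' with
    | add p p' hp hp' => rw [map_add]; exact add_mem hp hp'
    | monomial e c =>
      have hc : MvPolynomial.monomial e c = c • MvPolynomial.monomial e (1 : R) := by
        simp [MvPolynomial.smul_monomial]
      rw [hc, map_smul]
      refine Submodule.smul_mem _ _ ?_
      convert det_aeval_mem_span q hq fun i => X ^ e i using 1
      rw [← Matrix.det_transpose, Matrix.det_apply]
      simp only [A, LinearMap.sum_apply]
      refine Finset.sum_congr rfl fun σ _ => ?_
      rw [LinearMap.smul_apply, Units.smul_def, MvPolynomial.monomial_eq,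
        Finsupp.prod_fintype _ _ (by simp)]
      simp
  have hAW : A W = (Fintype.card (Equiv.Perm (Fin n)) : R) • W := by
    simp only [A, LinearMap.sum_apply, LinearMap.smul_apply, AlgHom.toLinearMap_apply, hW]
    rw [Finset.sum_congr rfl fun σ _ => show (Equiv.Perm.sign σ : ℤ) •
      (((Equiv.Perm.sign σ : ℤ) : MvPolynomial (Fin n) R) * W) = W by
        rw [zsmul_eq_mul, ← mul_assoc, ← Int.cast_mul]; simp [← Units.val_mul]]
    simp [MvPolynomial.smul_eq_C_mul]
  have h := hA W
  rw [hAW] at h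
  exact (Submodule.smul_mem_iff _ (by exact_mod_cast Fintype.card_ne_zero)).1 h

/-! ### Newton interpolation products -/

/-- The Newton interpolation product `∏_{l<m} (x - u_l)`. -/
def newtonProd {R : Type*} [CommRing R] (u : ℕ → R) (m : ℕ) (x : R) : R :=
  ∏ l ∈ Finset.range m, (x - u l)

section newton

variable {R : Type*} [CommRing R] (u : ℕ → R)

theorem newtonProd_zero (x : R) : newtonProd u 0 x = 1 := by simp [newtonProd]

theorem newtonProd_succ (m : ℕ) (x : R) :
    newtonProd u (m + 1) x = newtonProd u m x * (x - u m) := by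
  simp [newtonProd, Finset.prod_range_succ]

theorem newtonProd_node_eq_zero {n m : ℕ} (h : n < m) : newtonProd u m (u n) = 0 :=
  Finset.prod_eq_zero (Finset.mem_range.2 h) (sub_self _)

/-- The sum telescopes through `T - x = (T - u_m) - (x - u_m)`. -/
theorem newtonProd_sub (x T : R) (D : ℕ) :
    (T - x) * ∑ m ∈ Finset.range D, newtonProd u m x * ∏ l ∈ Finset.Ico (m + 1) D, (T - u l) =
      newtonProd u D T - newtonProd u D x := by
  induction D with
  | zero => simp [newtonProd]
  | succ D ih =>
    rw [Finset.sum_range_succ]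
    have h : ∀ m ∈ Finset.range D, newtonProd u m x * ∏ l ∈ Finset.Ico (m + 1) (D + 1), (T - u l) =
        (newtonProd u m x * ∏ l ∈ Finset.Ico (m + 1) D, (T - u l)) * (T - u D) := by
      intro m hm
      rw [Finset.prod_Ico_succ_top (Nat.succ_le_of_lt (Finset.mem_range.1 hm)), mul_assoc]
    rw [Finset.sum_congr rfl h, ← Finset.sum_mul, mul_add, ← mul_assoc, ih, newtonProd_succ,
      newtonProd_succ]
    simp
    ring

/-- The polynomial `∏_{l<m} (X - u_l)`. -/
def newtonPoly (m : ℕ) : R[X] := ∏ l ∈ Finset.range m, (X - C (u l))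

theorem newtonPoly_monic (m : ℕ) : (newtonPoly u m).Monic :=
  monic_prod_of_monic _ _ fun _ _ => monic_X_sub_C _

theorem natDegree_newtonPoly [Nontrivial R] (m : ℕ) : (newtonPoly u m).natDegree = m := by
  rw [newtonPoly, natDegree_prod_of_monic _ _ fun _ _ => monic_X_sub_C _]
  simp

theorem eval_newtonPoly (m : ℕ) (x : R) : (newtonPoly u m).eval x = newtonProd u m x := by
  simp [newtonPoly, newtonProd, eval_prod]

/-- `det [∏_{l<j} (x_i - u_l)]` is the Vandermonde determinant of the `x_i`. -/
theorem det_newtonProd [Nontrivial R] {n : ℕ} (x : Fin n → R) :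
    (Matrix.of fun i j : Fin n => newtonProd u j (x i)).det = (Matrix.vandermonde x).det := by
  rw [Matrix.det_eval_matrixOfPolynomials_eq_det_vandermonde x (fun j => newtonPoly u j)
    (fun j => natDegree_newtonPoly u j) (fun j => newtonPoly_monic u j)]
  simp only [eval_newtonPoly]

end newton

/-! ### Vandermonde and Cauchy-Vandermonde determinants -/

theorem prod_prod_erase_sub {F : Type*} [CommRing F] {K : ℕ} (T : Fin K → F) :
    ∏ j : Fin K, ∏ l ∈ Finset.univ.erase j, (T j - T l) =
      (∏ j : Fin K, ∏ _l ∈ Finset.Ioi j, (-1 : F)) * (Matrix.vandermonde T).det ^ 2 := by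
  have h1 : ∀ j : Fin K, ∏ l ∈ Finset.univ.erase j, (T j - T l) =
      (∏ l ∈ Finset.Iio j, (T j - T l)) * ∏ l ∈ Finset.Ioi j, (-1) * (T l - T j) := by
    intro j
    have hd : Disjoint (Finset.Iio j) (Finset.Ioi j) := by
      rw [Finset.disjoint_left]
      intro l hl hl'
      exact lt_asymm (Finset.mem_Iio.1 hl) (Finset.mem_Ioi.1 hl')
    have hu : Finset.univ.erase j = (Finset.Iio j).disjUnion (Finset.Ioi j) hd := by
      ext l
      simp [lt_or_lt_iff_ne]
    rw [hu, Finset.prod_disjUnion]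
    congr 1
    exact Finset.prod_congr rfl fun l _ => by ring
  simp_rw [h1, Finset.prod_mul_distrib]
  have h2 : ∏ j : Fin K, ∏ l ∈ Finset.Iio j, (T j - T l) = (Matrix.vandermonde T).det := by
    rw [Matrix.det_vandermonde]
    exact Finset.prod_comm' (by simp)
  rw [h2, Matrix.det_vandermonde]
  ring

section cauchy

variable {F : Type*} [Field F] {K : ℕ}

/-- The polynomial `∏_{l≠j} (X - T_l)`. -/
def lagrangeNum (T : Fin K → F) (j : Fin K) : F[X] :=
  ∏ l ∈ Finset.univ.erase j, (X - C (T l))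

theorem natDegree_lagrangeNum (T : Fin K → F) (j : Fin K) : (lagrangeNum T j).natDegree < K := by
  rw [lagrangeNum, natDegree_prod_of_monic _ _ fun _ _ => monic_X_sub_C _]
  simp [Finset.card_erase_of_mem]
  exact j.pos

theorem eval_lagrangeNum_eq_sum (T : Fin K → F) (j : Fin K) (x : F) :
    (lagrangeNum T j).eval x = ∑ k : Fin K, x ^ (k : ℕ) * (lagrangeNum T j).coeff k := by
  rw [eval_eq_sum_range' (natDegree_lagrangeNum T j), Finset.sum_range]
  simp only [mul_comm]

theorem eval_lagrangeNum (T : Fin K → F) (j : Fin K) (x : F) :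
    (lagrangeNum T j).eval x = ∏ l ∈ Finset.univ.erase j, (x - T l) := by
  simp [lagrangeNum, eval_prod]

/-- The Vandermonde matrix of `T` times the coefficient matrix lists the values of the Lagrange
numerators at the `T i`. It is diagonal, and its determinant is the square of the Vandermonde
determinant up to sign. -/
theorem det_coeff_lagrangeNum (T : Fin K → F) (hT : Function.Injective T) :
    (Matrix.of fun k j : Fin K => (lagrangeNum T j).coeff k).det =
      (∏ j : Fin K, ∏ _l ∈ Finset.Ioi j, (-1 : F)) * (Matrix.vandermonde T).det := by
  have hne : (Matrix.vandermonde T).det ≠ 0 := Matrix.det_vandermonde_ne_zero_iff.2 hT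
  have h : Matrix.vandermonde T * (Matrix.of fun k j : Fin K => (lagrangeNum T j).coeff k) =
      Matrix.diagonal fun j => ∏ l ∈ Finset.univ.erase j, (T j - T l) := by
    ext i j
    rw [Matrix.mul_apply]
    simp only [Matrix.vandermonde_apply, Matrix.of_apply]
    rw [← eval_lagrangeNum_eq_sum, eval_lagrangeNum]
    by_cases hij : i = j
    · subst hij; simp
    · rw [Matrix.diagonal_apply_ne _ hij]
      exact Finset.prod_eq_zero (i := i) (by simp [hij]) (sub_self _)
  have h2 := congrArg Matrix.det h
  rw [Matrix.det_mul, Matrix.det_diagonal, prod_prod_erase_sub] at h2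
  refine mul_left_cancel₀ hne (h2.trans ?_)
  ring

/-- A mixed Cauchy-Vandermonde determinant, up to a constant that depends on the sizes only. -/
theorem exists_cauchyVandermonde (u : ℕ → F) (K M : ℕ) : ∃ θ : F,
    ∀ (x : Fin (K + M) → F) (T : Fin K → F), Function.Injective T → (∀ i j, T j ≠ x i) →
      (Matrix.of fun i j : Fin (K + M) =>
        (Fin.append (fun j : Fin K => newtonProd u M (x i) / (T j - x i))
          (fun m : Fin M => newtonProd u m (x i)) : Fin (K + M) → F) j).det *
        ∏ j, ∏ i, (T j - x i) =
      θ * (Matrix.vandermonde x).det * (Matrix.vandermonde T).det * ∏ j, newtonProd u M (T j) := by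
  -- The first sign turns each `T j - x i` into `x i - T j`, the second comes from the factors
  -- `-newtonProd u M (T j)`, and the last from `det_coeff_lagrangeNum`.
  refine ⟨((-1) ^ K) ^ (K + M) * ((-1) ^ K * ∏ j : Fin K, ∏ _l ∈ Finset.Ioi j, (-1 : F)),
    fun x T hT hx => ?_⟩
  set A := (Matrix.of fun i j : Fin (K + M) =>
        (Fin.append (fun j : Fin K => newtonProd u M (x i) / (T j - x i))
          (fun m : Fin M => newtonProd u m (x i)) : Fin (K + M) → F) j) with hA
  let w : F[X] := ∏ l, (X - C (T l))
  have hw : ∀ y, w.eval y = ∏ l, (y - T l) := fun y => by simp [w, eval_prod]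
  have hwm : w.Monic := monic_prod_of_monic _ _ fun _ _ => monic_X_sub_C _
  have hwd : w.natDegree = K := by
    rw [natDegree_prod_of_monic _ _ fun _ _ => monic_X_sub_C _]; simp
  -- A monic basis with one polynomial in each degree, adapted to the two blocks: the powers below
  -- `K`, then the Newton polynomials times `w`.
  let p : Fin (K + M) → F[X] := Fin.append (fun k : Fin K => X ^ (k : ℕ))
    (fun m : Fin M => newtonPoly u m * w)
  have hP := Matrix.det_eval_matrixOfPolynomials_eq_det_vandermonde x p
    (by
      refine Fin.addCases (fun k => ?_) (fun m => ?_)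
      · simp [p]
      · simp only [p, Fin.append_right, Fin.val_natAdd]
        rw [(newtonPoly_monic u m).natDegree_mul hwm, natDegree_newtonPoly, hwd, add_comm])
    (by
      refine Fin.addCases (fun k => ?_) (fun m => ?_)
      · simp [p, monic_X_pow]
      · simp only [p, Fin.append_right]
        exact (newtonPoly_monic u m).mul hwm)
  -- After multiplication by `w (x i)` the Cauchy columns are polynomial in `x i`. By
  -- `newtonProd_sub` they are `-newtonProd u M (T j)` times the Lagrange numerator, plus multiples
  -- of the columns `newtonPoly u m * w`.
  have hfac : (Matrix.of fun i j => w.eval (x i) * A i j).submatrix finSumFinEquiv finSumFinEquiv =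
      (Matrix.of fun i j => (p j).eval (x i)).submatrix finSumFinEquiv finSumFinEquiv *
        Matrix.fromBlocks
          (Matrix.of fun k j : Fin K => (-newtonProd u M (T j)) *
            (Matrix.of fun k j : Fin K => (lagrangeNum T j).coeff k) k j) 0
          (Matrix.of fun (m : Fin M) (j : Fin K) =>
            -∏ l ∈ Finset.Ico ((m : ℕ) + 1) M, (T j - u l)) 1 := by
    ext i (j | j)
    · rw [Matrix.mul_apply, Fintype.sum_sum_type]
      simp only [Matrix.submatrix_apply, finSumFinEquiv_apply_left, finSumFinEquiv_apply_right,
        Matrix.of_apply, hA, Fin.append_left, Fin.append_right, p, Matrix.fromBlocks_apply₁₁,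
        Matrix.fromBlocks_apply₂₁, eval_mul, eval_pow, eval_X, eval_newtonPoly]
      generalize finSumFinEquiv i = i'
      have hne : T j - x i' ≠ 0 := sub_ne_zero.2 (hx i' j)
      have hwl : w.eval (x i') = -(T j - x i') * (lagrangeNum T j).eval (x i') := by
        rw [hw, eval_lagrangeNum, ← Finset.mul_prod_erase _ _ (Finset.mem_univ j)]
        ring
      have h1 : ∑ k : Fin K, x i' ^ (k : ℕ) * (-newtonProd u M (T j) * (lagrangeNum T j).coeff k) =
          -newtonProd u M (T j) * (lagrangeNum T j).eval (x i') := by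
        rw [eval_lagrangeNum_eq_sum, Finset.mul_sum]
        exact Finset.sum_congr rfl fun k _ => by ring
      have h2 : ∑ m : Fin M, newtonProd u m (x i') * w.eval (x i') *
          -∏ l ∈ Finset.Ico ((m : ℕ) + 1) M, (T j - u l) =
          (lagrangeNum T j).eval (x i') * (newtonProd u M (T j) - newtonProd u M (x i')) := by
        rw [← newtonProd_sub, Finset.sum_range, hwl, Finset.mul_sum, Finset.mul_sum]
        exact Finset.sum_congr rfl fun m _ => by ring
      rw [h1, h2, hwl]
      field_simp
      ring
    · rw [Matrix.mul_apply, Fintype.sum_sum_type]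
      simp only [Matrix.submatrix_apply, finSumFinEquiv_apply_left, finSumFinEquiv_apply_right,
        Matrix.of_apply, hA, Fin.append_left, Fin.append_right, p, Matrix.fromBlocks_apply₁₂,
        Matrix.fromBlocks_apply₂₂, eval_mul, eval_pow, eval_X, eval_newtonPoly, Matrix.zero_apply,
        mul_zero, Finset.sum_const_zero, zero_add, Matrix.one_apply]
      simp [mul_comm]
  have hdet := congrArg Matrix.det hfac
  rw [Matrix.det_mul, Matrix.det_submatrix_equiv_self, Matrix.det_submatrix_equiv_self,
    Matrix.det_fromBlocks_zero₁₂, Matrix.det_one, mul_one, Matrix.det_mul_column,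
    Matrix.det_mul_row, det_coeff_lagrangeNum T hT, ← hP] at hdet
  have hsign : ∏ j, ∏ i, (T j - x i) = ((-1) ^ K) ^ (K + M) * ∏ i, w.eval (x i) := by
    rw [Finset.prod_comm]
    have : ∀ i, ∏ j, (T j - x i) = (-1) ^ K * w.eval (x i) := by
      intro i
      rw [hw]
      have h3 : ∀ j, T j - x i = (-1) * (x i - T j) := fun j => by ring
      simp_rw [h3, Finset.prod_mul_distrib]
      simp
    simp_rw [this, Finset.prod_mul_distrib]
    simp
  have hneg : ∏ j, -newtonProd u M (T j) = (-1) ^ K * ∏ j, newtonProd u M (T j) := by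
    simp [Finset.prod_neg]
  rw [hneg] at hdet
  rw [hsign]
  linear_combination ((-1) ^ K) ^ (K + M) * hdet

/-- The determinant of a triangular family in the functions `∏_{l<m} (T - v_l)⁻¹`. -/
theorem det_sum_prod_inv (v : ℕ → F) (γ : ℕ → ℕ → F) {R : ℕ} (T : Fin R → F)
    (hT : ∀ j l, T j ≠ v l) :
    (Matrix.of fun i j : Fin R =>
      ∑ m ∈ Finset.range ((i : ℕ) + 1), γ i m * ∏ l ∈ Finset.range m, (T j - v l)⁻¹).det =
    (∏ i : Fin R, γ i i) * ((Equiv.Perm.sign (Fin.revPerm : Equiv.Perm (Fin R)) : ℤ) : F) *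
      (Matrix.vandermonde T).det * ∏ j, ∏ l ∈ Finset.range (R - 1), (T j - v l)⁻¹ := by
  -- Clearing the common denominator `∏_{l<R-1} (T j - v l)` turns row `i` into a monic polynomial
  -- of degree `R - 1 - i`, which is `p i.rev`; hence the sign of the reversal.
  let p : Fin R → F[X] := fun i => ∏ l ∈ Finset.Ico (R - 1 - (i : ℕ)) (R - 1), (X - C (v l))
  have hP := Matrix.det_eval_matrixOfPolynomials_eq_det_vandermonde T p
    (fun i => by
      rw [natDegree_prod_of_monic _ _ fun _ _ => monic_X_sub_C _]
      simp
      omega)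
    (fun i => monic_prod_of_monic _ _ fun _ _ => monic_X_sub_C _)
  let Γ : Matrix (Fin R) (Fin R) F := Matrix.of fun i m => if m ≤ i then γ i m else 0
  have hΓ : Γ.det = ∏ i : Fin R, γ i i := by
    rw [Matrix.det_of_isLowerTriangular]
    · simp [Γ]
    · intro i j hij
      have : i < j := hij
      simp [Γ, this]
  have hE : (Matrix.of fun i j : Fin R =>
      ∏ l ∈ Finset.range (i : ℕ), (T j - v l)⁻¹) = Matrix.of fun i j =>
        (∏ l ∈ Finset.range (R - 1), (T j - v l)⁻¹) *
        (((Matrix.of fun i j : Fin R => (p j).eval (T i)).transpose.submatrix Fin.revPerm id)) i j := by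
    ext i j
    have hi : (i : ℕ) ≤ R - 1 := by omega
    simp only [Matrix.of_apply, Matrix.submatrix_apply, Matrix.transpose_apply, id, p,
      Fin.revPerm_apply, Fin.val_rev, eval_prod, eval_sub, eval_X, eval_C]
    have h1 : R - 1 - (R - ((i : ℕ) + 1)) = i := by omega
    rw [h1, ← Finset.prod_range_mul_prod_Ico _ hi, mul_assoc, ← Finset.prod_mul_distrib]
    rw [Finset.prod_congr rfl fun l _ => inv_mul_cancel₀ (sub_ne_zero.2 (hT j l))]
    simp
  have hfac : (Matrix.of fun i j : Fin R =>
      ∑ m ∈ Finset.range ((i : ℕ) + 1), γ i m * ∏ l ∈ Finset.range m, (T j - v l)⁻¹) =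
      Γ * Matrix.of fun i j : Fin R => ∏ l ∈ Finset.range (i : ℕ), (T j - v l)⁻¹ := by
    ext i j
    rw [Matrix.mul_apply]
    simp only [Matrix.of_apply, Γ, ite_mul, zero_mul, Fin.le_def]
    rw [← Finset.sum_range (fun m => if m ≤ (i : ℕ) then
      γ i m * ∏ l ∈ Finset.range m, (T j - v l)⁻¹ else 0), ← Finset.sum_filter]
    refine Finset.sum_congr ?_ fun _ _ => rfl
    ext m
    simp
    omega
  rw [hfac, Matrix.det_mul, hΓ, hE, Matrix.det_mul_row, Matrix.det_permute, Matrix.det_transpose,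
    ← hP]
  ring

end cauchy

/-! ### The Jacobi weight -/

section weight

variable {a b : ℝ}

/-- The integral of a function against the Jacobi weight. -/
def jacobiInt (a b : ℝ) (f : ℝ → ℝ) : ℝ :=
  ∫ x in (-1 : ℝ)..1, f x * ((1 - x) ^ a * (1 + x) ^ b)

/-- The exponents may be negative, so the interval is cut at `0`: on each half only one factor can
be singular and the other is continuous. -/
theorem intervalIntegrable_jacobiWeight (ha : -1 < a) (hb : -1 < b) :
    IntervalIntegrable (fun x : ℝ => (1 - x) ^ a * (1 + x) ^ b) MeasureTheory.volume (-1) 1 := by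
  have h1 : IntervalIntegrable (fun x : ℝ => (1 - x) ^ a * (1 + x) ^ b)
      MeasureTheory.volume 0 1 := by
    have h := (intervalIntegral.intervalIntegrable_rpow' (a := 1) (b := 0) ha).comp_sub_left 1
    simp only [sub_self, sub_zero] at h
    refine h.mul_continuousOn ?_
    refine ContinuousOn.rpow_const (by fun_prop) fun x hx => Or.inl ?_
    rw [Set.uIcc_of_le zero_le_one] at hx
    linarith [hx.1]
  have h2 : IntervalIntegrable (fun x : ℝ => (1 - x) ^ a * (1 + x) ^ b)
      MeasureTheory.volume (-1) 0 := by
    have h := (intervalIntegral.intervalIntegrable_rpow' (a := 0) (b := 1) hb).comp_add_left 1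
    simp only [sub_self, zero_sub] at h
    refine h.continuousOn_mul ?_
    refine ContinuousOn.rpow_const (by fun_prop) fun x hx => Or.inl ?_
    rw [Set.uIcc_of_le (by norm_num)] at hx
    linarith [hx.2]
  exact h2.trans h1

theorem intervalIntegrable_mul_jacobiWeight (ha : -1 < a) (hb : -1 < b) {f : ℝ → ℝ}
    (hf : Continuous f) :
    IntervalIntegrable (fun x : ℝ => f x * ((1 - x) ^ a * (1 + x) ^ b))
      MeasureTheory.volume (-1) 1 :=
  (intervalIntegrable_jacobiWeight ha hb).continuousOn_mul hf.continuousOn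

theorem jacobiInt_add (ha : -1 < a) (hb : -1 < b) {f g : ℝ → ℝ} (hf : Continuous f)
    (hg : Continuous g) :
    jacobiInt a b (fun x => f x + g x) = jacobiInt a b f + jacobiInt a b g := by
  rw [jacobiInt, jacobiInt, jacobiInt, ← intervalIntegral.integral_add
    (intervalIntegrable_mul_jacobiWeight ha hb hf) (intervalIntegrable_mul_jacobiWeight ha hb hg)]
  simp only [add_mul]

theorem jacobiInt_const_mul (c : ℝ) (f : ℝ → ℝ) :
    jacobiInt a b (fun x => c * f x) = c * jacobiInt a b f := by
  rw [jacobiInt, jacobiInt, ← intervalIntegral.integral_const_mul]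
  simp only [mul_assoc]

/-- The integral of `p((1-x)/2)` against the Jacobi weight, as a linear functional of `p`. -/
def jacobiFunctional (ha : -1 < a) (hb : -1 < b) : ℝ[X] →ₗ[ℝ] ℝ where
  toFun p := jacobiInt a b fun x => p.eval ((1 - x) / 2)
  map_add' p q := by
    simp only [eval_add]
    exact jacobiInt_add ha hb (by fun_prop) (by fun_prop)
  map_smul' c p := by
    simp only [eval_smul, smul_eq_mul]
    exact jacobiInt_const_mul c _

theorem jacobiFunctional_apply (ha : -1 < a) (hb : -1 < b) (p : ℝ[X]) :
    jacobiFunctional ha hb p =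
      ∫ x in (-1 : ℝ)..1, p.eval ((1 - x) / 2) * ((1 - x) ^ a * (1 + x) ^ b) := rfl

/-- The Pearson equation of the Jacobi weight, in integrated form. -/
theorem jacobiFunctional_pearson (ha : -1 < a) (hb : -1 < b) (f : ℝ[X]) :
    jacobiFunctional ha hb
      (X * (1 - X) * derivative f + (C (a + 1) - C (a + b + 2) * X) * f) = 0 := by
  set g : ℝ[X] := X * (1 - X) * derivative f + (C (a + 1) - C (a + b + 2) * X) * f with hg
  -- Integrating the derivative of this function gives the claim. It vanishes at both endpoints
  -- because `a + 1` and `b + 1` are positive.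
  have hcont : ContinuousOn
      (fun x : ℝ => f.eval ((1 - x) / 2) * ((1 - x) ^ (a + 1) * (1 + x) ^ (b + 1)))
      (Set.Icc (-1) 1) := by
    refine Continuous.continuousOn ?_
    refine Continuous.mul (by fun_prop) (Continuous.mul ?_ ?_)
    · exact Continuous.rpow_const (by fun_prop) fun x => Or.inr (by linarith)
    · exact Continuous.rpow_const (by fun_prop) fun x => Or.inr (by linarith)
  have hderiv : ∀ x ∈ Set.Ioo (-1 : ℝ) 1, HasDerivAt
      (fun x : ℝ => f.eval ((1 - x) / 2) * ((1 - x) ^ (a + 1) * (1 + x) ^ (b + 1)))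
      ((-2) * (g.eval ((1 - x) / 2) * ((1 - x) ^ a * (1 + x) ^ b))) x := by
    intro x hx
    have h1 : 0 < 1 - x := by linarith [hx.2]
    have h2 : 0 < 1 + x := by linarith [hx.1]
    have d0 : HasDerivAt (fun x : ℝ => (1 - x) / 2) (-1 / 2) x := by
      simpa using ((hasDerivAt_id x).const_sub 1).div_const 2
    have d1 : HasDerivAt (fun x : ℝ => f.eval ((1 - x) / 2))
        ((derivative f).eval ((1 - x) / 2) * (-1 / 2)) x :=
      HasDerivAt.comp (h₂ := fun y => f.eval y) x (f.hasDerivAt _) d0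
    have d2 : HasDerivAt (fun x : ℝ => (1 - x) ^ (a + 1)) (-1 * (a + 1) * (1 - x) ^ (a + 1 - 1)) x :=
      ((hasDerivAt_id x).const_sub 1).rpow_const (Or.inl h1.ne')
    have d3 : HasDerivAt (fun x : ℝ => (1 + x) ^ (b + 1)) (1 * (b + 1) * (1 + x) ^ (b + 1 - 1)) x :=
      ((hasDerivAt_id x).const_add 1).rpow_const (Or.inl h2.ne')
    refine (d1.mul (d2.mul d3)).congr_deriv ?_
    simp only [Pi.mul_apply]
    rw [add_sub_cancel_right, add_sub_cancel_right, Real.rpow_add h1, Real.rpow_add h2,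
      Real.rpow_one, Real.rpow_one]
    simp only [hg, eval_add, eval_mul, eval_sub, eval_X, eval_C, eval_one]
    ring
  have hint : IntervalIntegrable
      (fun x : ℝ => (-2) * (g.eval ((1 - x) / 2) * ((1 - x) ^ a * (1 + x) ^ b)))
      MeasureTheory.volume (-1) 1 :=
    (intervalIntegrable_mul_jacobiWeight ha hb (by fun_prop)).const_mul _
  have h := intervalIntegral.integral_eq_sub_of_hasDerivAt_of_le (by norm_num) hcont hderiv hint
  rw [intervalIntegral.integral_const_mul] at h
  have hz1 : (1 - 1 : ℝ) ^ (a + 1) = 0 := by rw [sub_self, Real.zero_rpow (by linarith)]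
  have hz2 : (1 + -1 : ℝ) ^ (b + 1) = 0 := by rw [add_neg_cancel, Real.zero_rpow (by linarith)]
  rw [hz1, hz2] at h
  rw [jacobiFunctional_apply]
  linarith

/-- The integrand is nonnegative and vanishes inside the interval only at the finitely many points
coming from roots of `p`. -/
theorem jacobiFunctional_sq_pos (ha : -1 < a) (hb : -1 < b) {p : ℝ[X]} (hp : p ≠ 0) :
    0 < jacobiFunctional ha hb (p * p) := by
  rw [jacobiFunctional_apply, intervalIntegral.integral_of_le (by norm_num),
    MeasureTheory.integral_Ioc_eq_integral_Ioo]
  have hint := intervalIntegrable_mul_jacobiWeight ha hb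
    (f := fun x => (p * p).eval ((1 - x) / 2)) (by fun_prop)
  rw [intervalIntegrable_iff_integrableOn_Ioo_of_le (by norm_num)] at hint
  rw [MeasureTheory.setIntegral_pos_iff_support_of_nonneg_ae _ hint]
  · have hsub : Set.Ioo (-1 : ℝ) 1 \ ((fun x : ℝ => (1 - x) / 2) ⁻¹' (p.roots.toFinset : Set ℝ)) ⊆
        (Function.support fun x : ℝ =>
          (p * p).eval ((1 - x) / 2) * ((1 - x) ^ a * (1 + x) ^ b)) ∩ Set.Ioo (-1) 1 := by
      rintro x ⟨hx, hr⟩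
      refine ⟨?_, hx⟩
      have h1 : 0 < 1 - x := by linarith [hx.2]
      have h2 : 0 < 1 + x := by linarith [hx.1]
      have hr' : p.eval ((1 - x) / 2) ≠ 0 := by
        simpa [hp] using hr
      rw [Function.mem_support, eval_mul]
      have := Real.rpow_pos_of_pos h1 a
      have := Real.rpow_pos_of_pos h2 b
      positivity
    refine lt_of_lt_of_le ?_ (MeasureTheory.measure_mono hsub)
    have hfin : ((fun x : ℝ => (1 - x) / 2) ⁻¹' (p.roots.toFinset : Set ℝ)).Finite :=
      p.roots.toFinset.finite_toSet.preimage fun x _ y _ h => by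
        have : (1 - x) / 2 = (1 - y) / 2 := h
        linarith
    rw [MeasureTheory.measure_sdiff_null (hfin.measure_zero _)]
    simp
  · refine (MeasureTheory.ae_restrict_mem measurableSet_Ioo).mono fun x hx => ?_
    have h1 : 0 < 1 - x := by linarith [hx.2]
    have h2 : 0 < 1 + x := by linarith [hx.1]
    have := Real.rpow_pos_of_pos h1 a
    have := Real.rpow_pos_of_pos h2 b
    simp only [Pi.zero_apply, eval_mul]
    exact mul_nonneg (mul_self_nonneg _) (by positivity)

end weight

/-! ### Jacobi polynomials as hypergeometric polynomials -/

section hyp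

/-- The interpolation nodes `(l + ε)²`. -/
def node (ε : ℝ) (l : ℕ) : ℝ := ((l : ℝ) + ε) ^ 2

theorem node_strictMono {ε : ℝ} (hε : 0 ≤ ε) : StrictMono (node ε) := by
  intro l m h
  have h' : (l : ℝ) < m := by exact_mod_cast h
  have h0 : (0 : ℝ) ≤ l := l.cast_nonneg
  simp only [node]
  nlinarith

/-- The coefficients `(-1)^m / ((a+1)_m m!)`. -/
def hypCoeff (a : ℝ) (m : ℕ) : ℝ :=
  (-1) ^ m / ((ascPochhammer ℝ m).eval (a + 1) * (m.factorial : ℝ))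

variable {a b ε : ℝ}

theorem hypCoeff_ne_zero (ha : -1 < a) (m : ℕ) : hypCoeff a m ≠ 0 := by
  have := ascPochhammer_pos m (a + 1) (by linarith)
  rw [hypCoeff]
  positivity

theorem hypCoeff_zero (a : ℝ) : hypCoeff a 0 = 1 := by simp [hypCoeff]

theorem hypCoeff_succ (ha : -1 < a) (m : ℕ) :
    ((m : ℝ) + 1) * (m + a + 1) * hypCoeff a (m + 1) = -hypCoeff a m := by
  have h1 := ascPochhammer_pos m (a + 1) (by linarith)
  have h2 : (0 : ℝ) < a + 1 + m := by have := m.cast_nonneg (α := ℝ); linarith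
  have h3 : (m.factorial : ℝ) ≠ 0 := by exact_mod_cast m.factorial_ne_zero
  rw [hypCoeff, hypCoeff, ascPochhammer_succ_eval, Nat.factorial_succ]
  push_cast
  field_simp
  ring

/-- The polynomial `₂F₁(-n, n + 2ε; a + 1; X)`. -/
def hypPoly (a ε : ℝ) (n : ℕ) : ℝ[X] :=
  ∑ m ∈ Finset.range (n + 1),
    C (hypCoeff a m * newtonProd (node ε) m (node ε n)) * X ^ m

theorem coeff_hypPoly (n m : ℕ) :
    (hypPoly a ε n).coeff m = hypCoeff a m * newtonProd (node ε) m (node ε n) := by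
  simp only [hypPoly, finsetSum_coeff, coeff_C_mul_X_pow]
  rw [Finset.sum_ite_eq]
  split_ifs with h
  · rfl
  · rw [newtonProd_node_eq_zero _ (by simpa using h), mul_zero]

theorem newtonProd_node_self_ne_zero (hε : 0 ≤ ε) (n : ℕ) :
    newtonProd (node ε) n (node ε n) ≠ 0 :=
  Finset.prod_ne_zero_iff.2 fun _ hl =>
    sub_ne_zero.2 (node_strictMono hε (Finset.mem_range.1 hl)).ne'

theorem natDegree_hypPoly (ha : -1 < a) (hε : 0 ≤ ε) (n : ℕ) : (hypPoly a ε n).natDegree = n := by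
  refine natDegree_eq_of_le_of_coeff_ne_zero ?_ ?_
  · rw [natDegree_le_iff_coeff_eq_zero]
    intro m hm
    rw [coeff_hypPoly, newtonProd_node_eq_zero _ hm, mul_zero]
  · rw [coeff_hypPoly]
    exact mul_ne_zero (hypCoeff_ne_zero ha n) (newtonProd_node_self_ne_zero hε n)

theorem hypPoly_ne_zero (ha : -1 < a) (hε : 0 ≤ ε) (n : ℕ) : hypPoly a ε n ≠ 0 := by
  intro h
  have := coeff_hypPoly (a := a) (ε := ε) n n
  rw [h, coeff_zero] at this
  exact mul_ne_zero (hypCoeff_ne_zero ha n) (newtonProd_node_self_ne_zero hε n) this.symm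

theorem eval_zero_hypPoly (n : ℕ) : (hypPoly a ε n).eval 0 = 1 := by
  rw [← coeff_zero_eq_eval_zero, coeff_hypPoly, newtonProd_zero, hypCoeff_zero, mul_one]

theorem coeff_X_mul_derivative (p : ℝ[X]) (m : ℕ) : (X * derivative p).coeff m = m * p.coeff m := by
  cases m with
  | zero => simp
  | succ m => rw [coeff_X_mul, coeff_derivative]; push_cast; ring

/-- The hypergeometric differential equation. -/
theorem hypPoly_ode (ha : -1 < a) (hab : ε = (a + b + 1) / 2) (n : ℕ) :
    X * (1 - X) * derivative (derivative (hypPoly a ε n)) +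
      (C (a + 1) - C (a + b + 2) * X) * derivative (hypPoly a ε n) =
    C (-((n : ℝ) * (n + 2 * ε))) * hypPoly a ε n := by
  -- Rewriting the operator through the Euler operator `X * derivative` makes the comparison of
  -- coefficients a two-term recurrence.
  set Q := hypPoly a ε n with hQ
  have hre : X * (1 - X) * derivative (derivative Q) +
      (C (a + 1) - C (a + b + 2) * X) * derivative Q =
      derivative (X * derivative Q) + C a * derivative Q - X * derivative (X * derivative Q) -
        C (a + b + 1) * (X * derivative Q) := by
    simp only [derivative_mul, derivative_X, map_add, map_one]
    have : (C (2 : ℝ) : ℝ[X]) = 2 := rfl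
    rw [this]
    ring
  rw [hre]
  ext m
  simp only [coeff_add, coeff_sub, coeff_C_mul, coeff_derivative, coeff_X_mul_derivative, hQ,
    coeff_hypPoly, newtonProd_succ]
  have h := hypCoeff_succ ha m
  have h2 : a + b + 1 = 2 * ε := by rw [hab]; ring
  rw [h2]
  have h3 : node ε n - node ε m = n * (n + 2 * ε) - m * (m + 2 * ε) := by
    simp only [node]; ring
  rw [h3]
  push_cast
  linear_combination
    (newtonProd (node ε) m (node ε n) * (n * (n + 2 * ε) - m * (m + 2 * ε))) * h

/-- The hypergeometric operator is symmetric for the weight, by the Pearson equation, and the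
eigenvalues `-n(n + 2ε)` are distinct because `ε ≥ 0`. -/
theorem jacobiFunctional_hypPoly_mul (ha : -1 < a) (hb : -1 < b) (hε : 0 ≤ ε)
    (hab : ε = (a + b + 1) / 2) {n m : ℕ} (hnm : n ≠ m) :
    jacobiFunctional ha hb (hypPoly a ε n * hypPoly a ε m) = 0 := by
  have key : ∀ n m : ℕ, -((n : ℝ) * (n + 2 * ε)) *
      jacobiFunctional ha hb (hypPoly a ε n * hypPoly a ε m) =
      -jacobiFunctional ha hb
        (X * (1 - X) * derivative (hypPoly a ε n) * derivative (hypPoly a ε m)) := by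
    intro n m
    have h1 := jacobiFunctional_pearson ha hb (derivative (hypPoly a ε n) * hypPoly a ε m)
    have h2 : X * (1 - X) * derivative (derivative (hypPoly a ε n) * hypPoly a ε m) +
        (C (a + 1) - C (a + b + 2) * X) * (derivative (hypPoly a ε n) * hypPoly a ε m) =
        (-((n : ℝ) * (n + 2 * ε))) • (hypPoly a ε n * hypPoly a ε m) +
        X * (1 - X) * derivative (hypPoly a ε n) * derivative (hypPoly a ε m) := by
      rw [smul_eq_C_mul, ← mul_assoc (C _), ← hypPoly_ode ha hab n, derivative_mul]
      ring
    rw [h2, map_add, map_smul, smul_eq_mul] at h1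
    linarith
  have h1 := key n m
  have h2 := key m n
  rw [mul_comm (hypPoly a ε m), mul_right_comm (X * (1 - X))] at h2
  have h3 : ((n : ℝ) * (n + 2 * ε) - m * (m + 2 * ε)) *
      jacobiFunctional ha hb (hypPoly a ε n * hypPoly a ε m) = 0 := by linarith
  refine (mul_eq_zero.1 h3).resolve_left fun h4 => hnm ((node_strictMono hε).injective ?_)
  simp only [node]
  linarith

/-- The affine change of variable `(1 - X) / 2`. -/
def halfOneSub : ℝ[X] := C (1 / 2) * (1 - X)

theorem eval_comp_halfOneSub (p : ℝ[X]) (x : ℝ) :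
    (p.comp halfOneSub).eval x = p.eval ((1 - x) / 2) := by
  rw [eval_comp]
  congr 1
  simp [halfOneSub]
  ring

theorem jacobiForm_comp (ha : -1 < a) (hb : -1 < b) (p q : ℝ[X]) :
    jacobiForm a b (p.comp halfOneSub) (q.comp halfOneSub) = jacobiFunctional ha hb (p * q) := by
  rw [jacobiFunctional_apply, jacobiForm]
  simp only [eval_comp_halfOneSub, eval_mul]

theorem exists_comp_halfOneSub (p : ℝ[X]) : ∃ q : ℝ[X], q.comp halfOneSub = p := by
  refine ⟨p.comp (1 - C 2 * X), ?_⟩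
  rw [comp_assoc]
  have : (1 - C 2 * X : ℝ[X]).comp halfOneSub = X := by
    simp only [halfOneSub, sub_comp, mul_comp, one_comp, C_comp, X_comp, ← mul_assoc, ← C_mul]
    norm_num
  rw [this, comp_X]

/-- The monic polynomial proportional to `₂F₁(-n, n + 2ε; a + 1; (1 - X) / 2)`. -/
def monicHyp (a ε : ℝ) (n : ℕ) : ℝ[X] :=
  C ((hypPoly a ε n).comp halfOneSub).leadingCoeff⁻¹ * (hypPoly a ε n).comp halfOneSub

theorem natDegree_halfOneSub : halfOneSub.natDegree = 1 := by
  have : halfOneSub = C (-1 / 2) * X + C (1 / 2) := by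
    simp only [halfOneSub, mul_sub, mul_one]
    rw [neg_div, C_neg]; ring
  rw [this]
  exact natDegree_linear (by norm_num)

theorem natDegree_hypPoly_comp (ha : -1 < a) (hε : 0 ≤ ε) (n : ℕ) :
    ((hypPoly a ε n).comp halfOneSub).natDegree = n := by
  rw [natDegree_comp, natDegree_halfOneSub, natDegree_hypPoly ha hε, mul_one]

theorem hypPoly_comp_ne_zero (n : ℕ) : (hypPoly a ε n).comp halfOneSub ≠ 0 := by
  intro h
  have := eval_comp_halfOneSub (hypPoly a ε n) 1
  rw [h] at this
  simp [eval_zero_hypPoly] at this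

theorem monicHyp_monic (n : ℕ) : (monicHyp a ε n).Monic := by
  rw [Monic, monicHyp, leadingCoeff_mul, leadingCoeff_C]
  exact inv_mul_cancel₀ (leadingCoeff_ne_zero.2 (hypPoly_comp_ne_zero n))

theorem natDegree_monicHyp (ha : -1 < a) (hε : 0 ≤ ε) (n : ℕ) : (monicHyp a ε n).natDegree = n := by
  rw [monicHyp, natDegree_C_mul (inv_ne_zero (leadingCoeff_ne_zero.2 (hypPoly_comp_ne_zero n))),
    natDegree_hypPoly_comp ha hε]

theorem degree_monicHyp (ha : -1 < a) (hε : 0 ≤ ε) (n : ℕ) : (monicHyp a ε n).degree = n := by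
  rw [degree_eq_natDegree (monicHyp_monic n).ne_zero, natDegree_monicHyp ha hε]

theorem monicHyp_eq_comp (n : ℕ) : monicHyp a ε n =
    (C ((hypPoly a ε n).comp halfOneSub).leadingCoeff⁻¹ * hypPoly a ε n).comp halfOneSub := by
  rw [mul_comp, C_comp, monicHyp]

theorem jacobiForm_monicHyp_of_ne (ha : -1 < a) (hb : -1 < b) (hε : 0 ≤ ε)
    (hab : ε = (a + b + 1) / 2) {n m : ℕ} (hnm : n ≠ m) :
    jacobiForm a b (monicHyp a ε n) (monicHyp a ε m) = 0 := by
  rw [monicHyp_eq_comp, monicHyp_eq_comp, jacobiForm_comp ha hb, mul_mul_mul_comm, ← C_mul,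
    ← smul_eq_C_mul, map_smul, jacobiFunctional_hypPoly_mul ha hb hε hab hnm, smul_zero]

theorem jacobiForm_monicHyp_self (ha : -1 < a) (hb : -1 < b) (hε : 0 ≤ ε) (n : ℕ) :
    jacobiForm a b (monicHyp a ε n) (monicHyp a ε n) ≠ 0 := by
  rw [monicHyp_eq_comp, jacobiForm_comp ha hb]
  refine (jacobiFunctional_sq_pos ha hb (mul_ne_zero ?_ (hypPoly_ne_zero ha hε n))).ne'
  simpa using hypPoly_comp_ne_zero n

theorem jacobiForm_add_left (ha : -1 < a) (hb : -1 < b) (p q r : ℝ[X]) :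
    jacobiForm a b (p + q) r = jacobiForm a b p r + jacobiForm a b q r := by
  obtain ⟨p, rfl⟩ := exists_comp_halfOneSub p
  obtain ⟨q, rfl⟩ := exists_comp_halfOneSub q
  obtain ⟨r, rfl⟩ := exists_comp_halfOneSub r
  rw [← add_comp]
  simp only [jacobiForm_comp ha hb, add_mul, map_add]

theorem jacobiForm_C_mul_left (c : ℝ) (p r : ℝ[X]) :
    jacobiForm a b (C c * p) r = c * jacobiForm a b p r := by
  rw [jacobiForm, jacobiForm, ← intervalIntegral.integral_const_mul]
  simp only [eval_mul, eval_C, mul_assoc]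

theorem jacobiForm_sum_left (ha : -1 < a) (hb : -1 < b) {ι : Type*} (s : Finset ι)
    (p : ι → ℝ[X]) (r : ℝ[X]) :
    jacobiForm a b (∑ i ∈ s, p i) r = ∑ i ∈ s, jacobiForm a b (p i) r := by
  classical
  induction s using Finset.induction_on with
  | empty => simp [jacobiForm]
  | insert i s hi ih => rw [Finset.sum_insert hi, Finset.sum_insert hi, jacobiForm_add_left ha hb, ih]

/-- Expanding `X ^ n - monicHyp a ε n` in the lower `monicHyp a ε k`, orthogonality identifies the
coefficients with those of Gram-Schmidt. The division there is legitimate since the squared norms do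
not vanish. -/
theorem monicJacobi_eq_monicHyp (ha : -1 < a) (hb : -1 < b) (hε : 0 ≤ ε)
    (hab : ε = (a + b + 1) / 2) (n : ℕ) : monicJacobi a b n = monicHyp a ε n := by
  induction n using Nat.strong_induction_on with
  | _ n ih =>
    have hmem : X ^ n - monicHyp a ε n ∈ degreeLT ℝ n := by
      rw [mem_degreeLT]
      refine lt_of_lt_of_eq (degree_sub_lt_left ?_ (pow_ne_zero _ X_ne_zero) ?_) (degree_X_pow n)
      · rw [degree_X_pow, degree_monicHyp ha hε]
      · rw [(monicHyp_monic n).leadingCoeff, leadingCoeff_X_pow]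
    let S : Polynomial.Sequence ℝ := ⟨monicHyp a ε, degree_monicHyp ha hε⟩
    have hS : ∀ i, S i = monicHyp a ε i := fun _ => rfl
    rw [← S.span_degreeLT (fun i _ => by rw [hS, (monicHyp_monic i).leadingCoeff]; exact isUnit_one),
      ← Finset.coe_range] at hmem
    obtain ⟨d, hd⟩ : ∃ d : ℕ → ℝ, X ^ n - monicHyp a ε n =
        ∑ k ∈ Finset.range n, C (d k) * monicHyp a ε k := by
      obtain ⟨d, hd⟩ := Submodule.mem_span_image_finset_iff_exists_fun' ℝ |>.1 hmem
      exact ⟨d, by simp only [← hd, hS, smul_eq_C_mul]⟩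
    have hX : X ^ n = monicHyp a ε n + ∑ k ∈ Finset.range n, C (d k) * monicHyp a ε k := by
      rw [← hd]; ring
    have hform : ∀ k < n, jacobiForm a b (X ^ n) (monicHyp a ε k) =
        d k * jacobiForm a b (monicHyp a ε k) (monicHyp a ε k) := by
      intro k hk
      rw [hX, jacobiForm_add_left ha hb, jacobiForm_monicHyp_of_ne ha hb hε hab hk.ne', zero_add,
        jacobiForm_sum_left ha hb]
      simp only [jacobiForm_C_mul_left]
      rw [Finset.sum_eq_single k]
      · intro j _ hj
        rw [jacobiForm_monicHyp_of_ne ha hb hε hab hj, mul_zero]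
      · intro h
        exact absurd (Finset.mem_range.2 hk) h
    rw [monicJacobi]
    have hsum : ∑ k : Fin n, C (jacobiForm a b (X ^ n) (monicJacobi a b k) /
        jacobiForm a b (monicJacobi a b k) (monicJacobi a b k)) * monicJacobi a b k =
        ∑ k : Fin n, C (d k) * monicHyp a ε k := by
      refine Finset.sum_congr rfl fun k _ => ?_
      rw [ih k k.2, hform k k.2, mul_div_cancel_right₀ _ (jacobiForm_monicHyp_self ha hb hε k)]
    rw [hsum, ← Finset.sum_range (fun k => C (d k) * monicHyp a ε k), ← hd]
    ring

/-- The classical hypergeometric formula for the Jacobi polynomials. -/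
theorem jacobiPoly_eq (ha : -1 < a) (hb : -1 < b) (hε : 0 ≤ ε)
    (hab : ε = (a + b + 1) / 2) (n : ℕ) :
    jacobiPoly a b n = C ((ascPochhammer ℝ n).eval (a + 1) / (n.factorial : ℝ)) *
      (hypPoly a ε n).comp halfOneSub := by
  have h0 : ((hypPoly a ε n).comp halfOneSub).leadingCoeff ≠ 0 :=
    leadingCoeff_ne_zero.2 (hypPoly_comp_ne_zero n)
  rw [jacobiPoly, monicJacobi_eq_monicHyp ha hb hε hab, monicHyp, eval_mul, eval_C,
    eval_comp_halfOneSub, ← mul_assoc, ← C_mul]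
  congr 2
  simp only [sub_self, zero_div, eval_zero_hypPoly]
  field_simp

end hyp

/-! ### Constant terms through the Vandermonde product -/

section corner

variable {R : Type*} [CommRing R]

theorem blockSign_zero (M : ℕ) : blockSign 0 M = 1 := by
  have h : (rowBlocks 0 M).symm.trans finSumFinEquiv = Equiv.refl _ := by
    ext i
    obtain ⟨j, rfl⟩ := (rowBlocks 0 M).surjective i
    rcases j with j | j
    · exact j.elim0
    · simp [rowBlocks_inr]
  rw [blockSign, h]
  exact Equiv.Perm.sign_refl

/-- This is `mvFunctional_specializeZeros` with no surviving variable: only the coefficient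
functionals remain. The length is a separate `n` because `0 + M` is not definitionally `M`. -/
theorem mvFunctional_eval_zero_aux (M n : ℕ) (h : n = 0 + M) (P : MvPolynomial (Fin n) R) :
    mvFunctional R (fun (j : Fin n) (e : ℕ) => if e = (j : ℕ) then (1 : R) else 0)
      (mvVandermonde R n * P) = MvPolynomial.eval 0 P := by
  subst h
  have h1 := mvFunctional_specializeZeros (A := R) (fun (j : Fin 0) (_ : ℕ) => (0 : R)) P
  have h2 : extendFunctional M (fun (j : Fin 0) (_ : ℕ) => (0 : R)) =
      fun (j : Fin (0 + M)) (e : ℕ) => if e = (j : ℕ) then (1 : R) else 0 := by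
    ext j e
    refine Fin.addCases (fun j => j.elim0) (fun m => ?_) j
    rw [extendFunctional, Fin.append_right, Fin.val_natAdd, zero_add]
  have h3 : mvVandermonde R 0 = 1 := by simp [mvVandermonde]
  rw [h2, blockSign_zero, h3, one_mul] at h1
  simp only [Units.val_one, Int.cast_one, one_mul] at h1
  rw [h1]
  have h4 : ∀ q : MvPolynomial (Fin 0) R,
      mvFunctional R (fun (j : Fin 0) (_ : ℕ) => (0 : R)) q = MvPolynomial.eval 0 q := by
    intro q
    obtain ⟨c, rfl⟩ := MvPolynomial.C_surjective (Fin 0) q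
    rw [← MvPolynomial.monomial_zero', mvFunctional_monomial]
    simp
  rw [h4, specializeZeros, ← MvPolynomial.coe_aeval_eq_eval, ← MvPolynomial.coe_aeval_eq_eval]
  have h5 : (MvPolynomial.aeval (0 : Fin 0 → R)).comp (MvPolynomial.aeval
      (Fin.append MvPolynomial.X fun _ => 0) : MvPolynomial (Fin (0 + M)) R →ₐ[R] _) =
      MvPolynomial.aeval 0 := by
    ext j
    refine Fin.addCases (fun j => j.elim0) (fun m => ?_) j
    rw [AlgHom.comp_apply, MvPolynomial.aeval_X, MvPolynomial.aeval_X, Fin.append_right, map_zero,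
      Pi.zero_apply]
  exact DFunLike.congr_fun h5 P

/-- The coefficient of `∏ X_j ^ j` in `∏_{i<j} (X_j - X_i) P` is the constant term of `P`. -/
theorem mvFunctional_mvVandermonde_mul {n : ℕ} (P : MvPolynomial (Fin n) R) :
    mvFunctional R (fun (j : Fin n) (e : ℕ) => if e = (j : ℕ) then (1 : R) else 0)
      (mvVandermonde R n * P) = MvPolynomial.eval 0 P :=
  mvFunctional_eval_zero_aux n n (zero_add n).symm P

end corner

theorem det_aeval_of_natDegree {F A : Type*} [Field F] [CommRing A] [Nontrivial A] [Algebra F A]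
    {n : ℕ} (q : ℕ → F[X]) (hq0 : ∀ i, q i ≠ 0) (hq : ∀ i, (q i).natDegree = i) (s : Fin n → A) :
    (Matrix.of fun i j : Fin n => Polynomial.aeval (s j) (q i)).det =
      algebraMap F A (∏ i : Fin n, (q i).leadingCoeff) * (Matrix.vandermonde s).det := by
  have hl : ∀ i, (q i).leadingCoeff ≠ 0 := fun i => leadingCoeff_ne_zero.2 (hq0 i)
  let p : ℕ → F[X] := fun i => C (q i).leadingCoeff⁻¹ * q i
  have hpm : ∀ i, (p i).Monic := fun i => by
    rw [Monic, leadingCoeff_mul, leadingCoeff_C, inv_mul_cancel₀ (hl i)]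
  have hpq : ∀ i, q i = C (q i).leadingCoeff * p i := fun i => by
    rw [← mul_assoc, ← C_mul, mul_inv_cancel₀ (hl i), C_1, one_mul]
  rw [Matrix.det_eval_matrixOfPolynomials_eq_det_vandermonde s
    (fun i => (p i).map (algebraMap F A))
    (fun i => by rw [(hpm i).natDegree_map, natDegree_C_mul (inv_ne_zero (hl i)), hq])
    (fun i => (hpm i).map _), map_prod, ← Matrix.det_transpose (Matrix.of fun i j : Fin n =>
      eval (s i) _), ← Matrix.det_mul_column]
  congr 1
  ext1 i j
  simp only [Matrix.of_apply, Matrix.transpose_apply, eval_map_algebraMap]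
  conv_lhs => rw [hpq i]
  simp

/-! ### Normalized multivariate Jacobi polynomials -/

section multivariate

variable {a b ε : ℝ} {N : ℕ}

/-- The substitution `X_j ↦ 1 - 2 X_j`. -/
def oneSubTwo (n : ℕ) : MvPolynomial (Fin n) ℝ →ₐ[ℝ] MvPolynomial (Fin n) ℝ :=
  MvPolynomial.aeval fun j => 1 - MvPolynomial.C 2 * MvPolynomial.X j

theorem oneSubTwo_X {n : ℕ} (j : Fin n) : oneSubTwo n (MvPolynomial.X j) =
    1 - MvPolynomial.C 2 * MvPolynomial.X j := MvPolynomial.aeval_X _ _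

theorem oneSubTwo_injective (n : ℕ) : Function.Injective (oneSubTwo n) := by
  let g : MvPolynomial (Fin n) ℝ →ₐ[ℝ] MvPolynomial (Fin n) ℝ :=
    MvPolynomial.aeval fun j => MvPolynomial.C (1 / 2) * (1 - MvPolynomial.X j)
  have h : g.comp (oneSubTwo n) = AlgHom.id ℝ _ := by
    ext1 j
    simp only [AlgHom.comp_apply, oneSubTwo_X, map_sub, map_mul, map_one, AlgHom.id_apply]
    have h1 : g (MvPolynomial.C 2) = MvPolynomial.C 2 := by
      simp only [g, MvPolynomial.algHom_C]
      rfl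
    have h2 : g (MvPolynomial.X j) = MvPolynomial.C (1 / 2) * (1 - MvPolynomial.X j) :=
      MvPolynomial.aeval_X _ _
    rw [h1, h2, ← mul_assoc, ← map_mul]
    norm_num
  exact Function.LeftInverse.injective (g := g) fun p => DFunLike.congr_fun h p

theorem eval_zero_oneSubTwo {n : ℕ} (p : MvPolynomial (Fin n) ℝ) :
    MvPolynomial.eval 0 (oneSubTwo n p) = MvPolynomial.eval (fun _ => (1 : ℝ)) p := by
  have h : (MvPolynomial.aeval (0 : Fin n → ℝ)).comp (oneSubTwo n) =
      MvPolynomial.aeval fun _ => (1 : ℝ) := by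
    ext j
    simp [oneSubTwo_X]
  exact DFunLike.congr_fun h p

theorem oneSubTwo_vandermondeProd (n : ℕ) :
    oneSubTwo n (vandermondeProd fun j : Fin n => MvPolynomial.X j) =
      MvPolynomial.C (∏ i : Fin n, ∏ _j ∈ Finset.Ioi i, 2) * mvVandermonde ℝ n := by
  rw [vandermondeProd, mvVandermonde_eq]
  simp only [map_prod, map_sub, oneSubTwo_X]
  rw [← Finset.prod_mul_distrib]
  refine Finset.prod_congr rfl fun i _ => ?_
  rw [← Finset.prod_mul_distrib]
  exact Finset.prod_congr rfl fun j _ => by ring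

theorem oneSubTwo_jacobiDet (ha : -1 < a) (hb : -1 < b) (hε : 0 ≤ ε)
    (hab : ε = (a + b + 1) / 2) (ν : PosSignature N) :
    oneSubTwo N (jacobiDet a b ν) =
      MvPolynomial.C (∏ i, (ascPochhammer ℝ (ν.shifted i)).eval (a + 1) /
        ((ν.shifted i).factorial : ℝ)) * mvDet (hypPoly a ε) ν.shifted := by
  rw [jacobiDet, AlgHom.map_det, map_prod, mvDet, ← Matrix.det_mul_column]
  congr 1
  ext1 i j
  simp only [AlgHom.mapMatrix_apply, Matrix.map_apply, Matrix.of_apply]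
  rw [← Polynomial.aeval_algHom_apply, oneSubTwo_X, jacobiPoly_eq ha hb hε hab, map_mul,
    Polynomial.aeval_comp, Polynomial.aeval_C]
  congr 2
  simp only [halfOneSub, map_mul, map_sub, map_one, Polynomial.aeval_C, Polynomial.aeval_X,
    MvPolynomial.algebraMap_eq]
  rw [sub_sub_cancel, ← mul_assoc, ← map_mul]
  norm_num

/-- The normalizing constant of `det [₂F₁(-n_i, n_i + 2ε; a + 1; X_j)]`. -/
def hypNorm (a ε : ℝ) (ν : PosSignature N) : ℝ :=
  (∏ j : Fin N, hypCoeff a j) * (Matrix.vandermonde fun i => node ε (ν.shifted i)).det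

theorem vandermonde_node_ne_zero (hε : 0 ≤ ε) (ν : PosSignature N) :
    (Matrix.vandermonde fun i => node ε (ν.shifted i)).det ≠ 0 :=
  Matrix.det_vandermonde_ne_zero_iff.2 <|
    (node_strictMono hε).injective.comp ν.shifted_strictAnti.injective

theorem hypNorm_ne_zero (ha : -1 < a) (hε : 0 ≤ ε) (ν : PosSignature N) : hypNorm a ε ν ≠ 0 :=
  mul_ne_zero (Finset.prod_ne_zero_iff.2 fun j _ => hypCoeff_ne_zero ha j)
    (vandermonde_node_ne_zero hε ν)

theorem polyFunctional_hypPoly {A : Type*} [CommRing A] [Algebra ℝ A] (ha : -1 < a) (hε : 0 ≤ ε)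
    (φ : ℕ → A) (n : ℕ) :
    polyFunctional ℝ φ (hypPoly a ε n) = ∑ m ∈ Finset.range (n + 1),
      (hypCoeff a m * newtonProd (node ε) m (node ε n)) • φ m := by
  rw [polyFunctional_eq_sum_range φ _
    (show (hypPoly a ε n).natDegree < n + 1 by rw [natDegree_hypPoly ha hε]; omega)]
  simp only [coeff_hypPoly]

theorem polyFunctional_hypPoly_coeff {A : Type*} [CommRing A] [Algebra ℝ A] (ha : -1 < a)
    (hε : 0 ≤ ε) (n k : ℕ) :
    polyFunctional ℝ (fun e => if e = k then (1 : A) else 0) (hypPoly a ε n) =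
      algebraMap ℝ A (hypCoeff a k * newtonProd (node ε) k (node ε n)) := by
  rw [polyFunctional_hypPoly ha hε]
  simp only [Algebra.smul_def, mul_ite, mul_zero, mul_one, Finset.sum_ite_eq']
  split_ifs with h
  · rfl
  · rw [newtonProd_node_eq_zero _ (by simpa using h)]
    simp

/-- Column `j` consists of the coefficients of `X ^ j`; extracting `hypCoeff a j` leaves Newton
products at the nodes, hence a Vandermonde determinant. -/
theorem mvFunctional_mvDet_hypPoly (ha : -1 < a) (hε : 0 ≤ ε) (ν : PosSignature N) :
    mvFunctional ℝ (fun (j : Fin N) (e : ℕ) => if e = (j : ℕ) then (1 : ℝ) else 0)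
      (mvDet (hypPoly a ε) ν.shifted) = hypNorm a ε ν := by
  rw [mvDet, mvFunctional_det, hypNorm, ← det_newtonProd (node ε), ← Matrix.det_mul_row]
  congr 1
  ext1 i j
  simp only [Matrix.of_apply, polyFunctional_hypPoly_coeff ha hε]
  rfl

/-- The normalized Jacobi polynomial in the variables `(1 - x_j) / 2`. -/
def jacobiY (a b : ℝ) (ν : PosSignature N) : MvPolynomial (Fin N) ℝ :=
  oneSubTwo N (jacobiMvNormalized a b ν)

/-- The value at `(1,…,1)`, where the defining quotient is `0/0` for `N ≥ 2`, is read off as a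
constant term by `mvFunctional_mvVandermonde_mul`. The constant `c` collects the one-variable
normalizations and the powers of `2` from the substitution. -/
theorem eval_one_jacobiMv (ha : -1 < a) (hb : -1 < b) (hε : 0 ≤ ε)
    (hab : ε = (a + b + 1) / 2) (ν : PosSignature N) :
    ∃ c : ℝ, c ≠ 0 ∧ MvPolynomial.eval (fun _ => (1 : ℝ)) (jacobiMv a b ν) = c * hypNorm a ε ν ∧
      mvVandermonde ℝ N * oneSubTwo N (jacobiMv a b ν) =
        MvPolynomial.C c * mvDet (hypPoly a ε) ν.shifted := by
  have h1 : jacobiDet a b ν = vandermondeProd (fun j : Fin N => MvPolynomial.X j) * jacobiMv a b ν :=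
    (vandermondeProd_dvd_jacobiDet a b ν).choose_spec
  have h2 := congrArg (oneSubTwo N) h1
  rw [map_mul, oneSubTwo_vandermondeProd, oneSubTwo_jacobiDet ha hb hε hab] at h2
  set A : ℝ := ∏ i, (ascPochhammer ℝ (ν.shifted i)).eval (a + 1) /
    ((ν.shifted i).factorial : ℝ) with hA
  set B : ℝ := ∏ i : Fin N, ∏ _j ∈ Finset.Ioi i, 2 with hB
  have hA0 : A ≠ 0 := Finset.prod_ne_zero_iff.2 fun i _ =>
    div_ne_zero (ascPochhammer_pos _ _ (by linarith)).ne'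
      (by exact_mod_cast (ν.shifted i).factorial_ne_zero)
  have hB0 : B ≠ 0 := Finset.prod_ne_zero_iff.2 fun i _ => Finset.prod_ne_zero_iff.2 fun _ _ =>
    two_ne_zero
  have h3 : mvVandermonde ℝ N * oneSubTwo N (jacobiMv a b ν) =
      MvPolynomial.C (A / B) * mvDet (hypPoly a ε) ν.shifted := by
    have hCB : (MvPolynomial.C B : MvPolynomial (Fin N) ℝ) ≠ 0 := by simpa using hB0
    refine mul_left_cancel₀ hCB ?_
    rw [← mul_assoc, ← h2, ← mul_assoc, ← map_mul, mul_div_cancel₀ _ hB0]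
  refine ⟨A / B, div_ne_zero hA0 hB0, ?_, h3⟩
  rw [← eval_zero_oneSubTwo, ← mvFunctional_mvVandermonde_mul, h3, ← MvPolynomial.smul_eq_C_mul,
    map_smul, mvFunctional_mvDet_hypPoly ha hε, smul_eq_mul]

theorem mvVandermonde_mul_jacobiY (ha : -1 < a) (hb : -1 < b) (hε : 0 ≤ ε)
    (hab : ε = (a + b + 1) / 2) (ν : PosSignature N) :
    MvPolynomial.C (hypNorm a ε ν) * (mvVandermonde ℝ N * jacobiY a b ν) =
      mvDet (hypPoly a ε) ν.shifted := by
  obtain ⟨c, hc, h1, h2⟩ := eval_one_jacobiMv ha hb hε hab ν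
  have hn := hypNorm_ne_zero ha hε ν
  rw [jacobiY, jacobiMvNormalized, h1, map_mul, MvPolynomial.algHom_C,
    mul_left_comm (mvVandermonde ℝ N), h2, MvPolynomial.algebraMap_eq, ← mul_assoc, ← mul_assoc,
    ← map_mul, ← map_mul]
  have : hypNorm a ε ν * (c * hypNorm a ε ν)⁻¹ * c = 1 := by field_simp
  rw [this, map_one, one_mul]

theorem eval_zero_jacobiY (ha : -1 < a) (hb : -1 < b) (hε : 0 ≤ ε)
    (hab : ε = (a + b + 1) / 2) (ν : PosSignature N) :
    MvPolynomial.eval 0 (jacobiY a b ν) = 1 := by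
  obtain ⟨c, hc, h1, h2⟩ := eval_one_jacobiMv ha hb hε hab ν
  rw [jacobiY, eval_zero_oneSubTwo, jacobiMvNormalized, map_mul, MvPolynomial.eval_C]
  exact inv_mul_cancel₀ (by rw [h1]; exact mul_ne_zero hc (hypNorm_ne_zero ha hε ν))

/-- For the zero signature the degrees are `N - 1, …, 0`, so the numerator is a constant multiple of
the Vandermonde product; the normalization fixes the constant. -/
theorem jacobiY_zero (ha : -1 < a) (hb : -1 < b) (hε : 0 ≤ ε)
    (hab : ε = (a + b + 1) / 2) : jacobiY a b (0 : PosSignature N) = 1 := by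
  have h1 := mvVandermonde_mul_jacobiY ha hb hε hab (0 : PosSignature N)
  have h2 : mvDet (hypPoly a ε) (0 : PosSignature N).shifted =
      MvPolynomial.C (((Equiv.Perm.sign (Fin.revPerm : Equiv.Perm (Fin N)) : ℤ) : ℝ) *
        ∏ i : Fin N, (hypPoly a ε i).leadingCoeff) * mvVandermonde ℝ N := by
    have h3 := det_aeval_of_natDegree (hypPoly a ε) (hypPoly_ne_zero ha hε)
      (natDegree_hypPoly ha hε) (fun j : Fin N => (MvPolynomial.X j : MvPolynomial (Fin N) ℝ))
    rw [mvVandermonde_eq, ← Matrix.det_vandermonde, map_mul, mul_assoc,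
      ← MvPolynomial.algebraMap_eq, ← h3, map_intCast, ← Matrix.det_permute, mvDet]
    simp only [PosSignature.zero_shifted]
    rfl
  rw [h2, mul_left_comm, mul_comm (MvPolynomial.C _) (mvVandermonde ℝ N)] at h1
  have h4 := mul_left_cancel₀ (mvVandermonde_ne_zero N) h1
  have h5 := congrArg (MvPolynomial.eval 0) h4
  rw [map_mul, eval_zero_jacobiY ha hb hε hab, MvPolynomial.eval_C, MvPolynomial.eval_C,
    mul_one] at h5
  rw [← h5] at h4
  have hne : (MvPolynomial.C (hypNorm a ε (0 : PosSignature N)) : MvPolynomial (Fin N) ℝ) ≠ 0 := by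
    simpa using hypNorm_ne_zero ha hε (0 : PosSignature N)
  exact mul_left_cancel₀ hne (by rw [h4, mul_one])

/-- Numerator and Vandermonde product change by the same sign. -/
theorem rename_jacobiY (ha : -1 < a) (hb : -1 < b) (hε : 0 ≤ ε)
    (hab : ε = (a + b + 1) / 2) (ν : PosSignature N) (σ : Equiv.Perm (Fin N)) :
    MvPolynomial.rename σ (jacobiY a b ν) = jacobiY a b ν := by
  have h1 := mvVandermonde_mul_jacobiY ha hb hε hab ν
  have h2 := congrArg (MvPolynomial.rename σ) h1
  rw [mvDet, rename_det_aeval (fun i => hypPoly a ε (ν.shifted i)) σ, ← mvDet, ← h1, map_mul,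
    map_mul, rename_mvVandermonde, MvPolynomial.rename_C] at h2
  have hne : (MvPolynomial.C (hypNorm a ε ν) * (((Equiv.Perm.sign σ : ℤ) :
      MvPolynomial (Fin N) ℝ) * mvVandermonde ℝ N)) ≠ 0 := by
    refine mul_ne_zero (by simpa using hypNorm_ne_zero ha hε ν)
      (mul_ne_zero ?_ (mvVandermonde_ne_zero N))
    exact_mod_cast (Equiv.Perm.sign σ).ne_zero
  refine mul_left_cancel₀ hne ?_
  linear_combination h2

end multivariate

/-! ### The expansion that defines `Λ` -/

section expansion

variable {a b ε : ℝ} {K M : ℕ}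

theorem oneSubTwo_specializeOnes (p : MvPolynomial (Fin (K + M)) ℝ) :
    oneSubTwo K (specializeOnes K p) = specializeZeros ℝ K M (oneSubTwo (K + M) p) := by
  let f : MvPolynomial (Fin (K + M)) ℝ →ₐ[ℝ] MvPolynomial (Fin K) ℝ := MvPolynomial.aeval
    (fun i : Fin (K + M) => if h : (i : ℕ) < K then
      (MvPolynomial.X ⟨i, h⟩ : MvPolynomial (Fin K) ℝ) else 1)
  have h : (oneSubTwo K).comp f = (specializeZeros ℝ K M).comp (oneSubTwo (K + M)) := by
    ext1 j
    simp only [AlgHom.comp_apply, f, MvPolynomial.aeval_X, oneSubTwo_X, map_sub, map_one, map_mul,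
      MvPolynomial.algHom_C, specializeZeros, MvPolynomial.algebraMap_eq]
    refine Fin.addCases (fun j => ?_) (fun m => ?_) j
    · rw [Fin.append_left, dif_pos (by simp), oneSubTwo_X]
      rfl
    · rw [Fin.append_right, dif_neg (by simp), map_one]
      simp
  exact DFunLike.congr_fun h p

theorem finsum_C_mul_eq_sum {c : PosSignature K → ℝ} (hc : c.support.Finite)
    (P : PosSignature K → MvPolynomial (Fin K) ℝ) :
    ∑ᶠ κ, MvPolynomial.C (c κ) * P κ = ∑ κ ∈ hc.toFinset, MvPolynomial.C (c κ) * P κ := by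
  refine finsum_eq_sum_of_support_subset _ fun κ hκ => ?_
  rw [hc.coe_toFinset, Function.mem_support]
  intro h
  exact hκ (by simp [h])

theorem isJacobiExpansion_iff (ν : PosSignature (K + M)) (c : PosSignature K → ℝ) :
    IsJacobiExpansion a b ν c ↔ ∃ hc : c.support.Finite,
      specializeZeros ℝ K M (jacobiY a b ν) =
        ∑ κ ∈ hc.toFinset, MvPolynomial.C (c κ) * jacobiY a b κ := by
  rw [IsJacobiExpansion, ← exists_prop]
  refine exists_congr fun hc => ?_
  rw [finsum_C_mul_eq_sum hc, ← (oneSubTwo_injective K).eq_iff, oneSubTwo_specializeOnes, map_sum]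
  simp only [map_mul, MvPolynomial.algHom_C, MvPolynomial.algebraMap_eq]
  rfl

theorem rename_specializeZeros (σ : Equiv.Perm (Fin K)) (P : MvPolynomial (Fin (K + M)) ℝ) :
    MvPolynomial.rename σ (specializeZeros ℝ K M P) = specializeZeros ℝ K M
      (MvPolynomial.rename (finSumFinEquiv.permCongr (Equiv.Perm.sumCongr σ 1)) P) := by
  have h : (MvPolynomial.rename σ).comp (specializeZeros ℝ K M) = (specializeZeros ℝ K M).comp
      (MvPolynomial.rename (finSumFinEquiv.permCongr (Equiv.Perm.sumCongr σ 1))) := by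
    ext1 j
    obtain ⟨j, rfl⟩ := finSumFinEquiv.surjective j
    simp only [AlgHom.comp_apply, specializeZeros, MvPolynomial.aeval_X, MvPolynomial.rename_X,
      Equiv.permCongr_apply, Equiv.symm_apply_apply]
    rcases j with j | j <;> simp
  exact DFunLike.congr_fun h P

/-- The specialization stays symmetric in the remaining variables, so its product with the
Vandermonde polynomial is alternating and lies in the span of the numerators. -/
theorem exists_isJacobiExpansion (ha : -1 < a) (hb : -1 < b) (hε : 0 ≤ ε)
    (hab : ε = (a + b + 1) / 2) (ν : PosSignature (K + M)) :
    ∃ c : PosSignature K → ℝ, IsJacobiExpansion a b ν c := by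
  have hspan : Submodule.span ℝ (Set.range (hypPoly a ε)) = ⊤ := by
    let S : Polynomial.Sequence ℝ := ⟨hypPoly a ε, fun i => by
      rw [degree_eq_natDegree (hypPoly_ne_zero ha hε i), natDegree_hypPoly ha hε]⟩
    exact S.span fun i => isUnit_iff_ne_zero.2 (leadingCoeff_ne_zero.2 (hypPoly_ne_zero ha hε i))
  have hmem := alternating_mem_span (hypPoly a ε) hspan
    (mvVandermonde ℝ K * specializeZeros ℝ K M (jacobiY a b ν)) fun σ => by
      rw [map_mul, rename_mvVandermonde, rename_specializeZeros, rename_jacobiY ha hb hε hab,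
        mul_assoc]
  obtain ⟨d, hd⟩ := Finsupp.mem_span_range_iff_exists_finsupp.1 hmem
  have hfin : (fun κ => d κ * hypNorm a ε κ).support.Finite :=
    d.hasFiniteSupport.subset fun κ hκ => by
      rw [Function.mem_support] at hκ ⊢
      exact left_ne_zero_of_mul hκ
  refine ⟨fun κ => d κ * hypNorm a ε κ, (isJacobiExpansion_iff ν _).2 ⟨hfin, ?_⟩⟩
  refine mul_left_cancel₀ (mvVandermonde_ne_zero K) ?_
  rw [← hd, Finsupp.sum, Finset.mul_sum]
  have hset : hfin.toFinset = d.support := by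
    ext κ
    simp [hypNorm_ne_zero ha hε]
  rw [hset]
  refine Finset.sum_congr rfl fun κ _ => ?_
  rw [← mvVandermonde_mul_jacobiY ha hb hε hab κ, MvPolynomial.smul_eq_C_mul, map_mul]
  ring

/-- Multiplying the difference of two expansions by the Vandermonde polynomial gives a relation
between the determinants of the `hypPoly`, which are linearly independent. -/
theorem isJacobiExpansion_unique (ha : -1 < a) (hb : -1 < b) (hε : 0 ≤ ε)
    (hab : ε = (a + b + 1) / 2) (ν : PosSignature (K + M)) {c d : PosSignature K → ℝ}
    (hc : IsJacobiExpansion a b ν c) (hd : IsJacobiExpansion a b ν d) : c = d := by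
  classical
  obtain ⟨hcf, hc⟩ := (isJacobiExpansion_iff ν c).1 hc
  obtain ⟨hdf, hd⟩ := (isJacobiExpansion_iff ν d).1 hd
  set s := hcf.toFinset ∪ hdf.toFinset with hs
  have hc0 : ∀ κ ∉ hcf.toFinset, c κ = 0 := fun κ hκ => by simpa using hκ
  have hd0 : ∀ κ ∉ hdf.toFinset, d κ = 0 := fun κ hκ => by simpa using hκ
  rw [Finset.sum_subset (Finset.subset_union_left (s₂ := hdf.toFinset))
    fun κ _ hκ => by simp [hc0 κ hκ]] at hc
  rw [Finset.sum_subset (Finset.subset_union_right (s₁ := hcf.toFinset))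
    fun κ _ hκ => by simp [hd0 κ hκ]] at hd
  have h0 : ∑ κ ∈ s, MvPolynomial.C ((c κ - d κ) / hypNorm a ε κ) *
      mvDet (hypPoly a ε) κ.shifted = 0 := by
    rw [← mul_zero (mvVandermonde ℝ K), ← sub_self (specializeZeros ℝ K M (jacobiY a b ν))]
    nth_rw 1 [hc]
    rw [hd, ← Finset.sum_sub_distrib, Finset.mul_sum]
    refine Finset.sum_congr rfl fun κ _ => ?_
    rw [← mvVandermonde_mul_jacobiY ha hb hε hab κ, ← mul_assoc, ← map_mul,
      div_mul_cancel₀ _ (hypNorm_ne_zero ha hε κ), map_sub]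
    ring
  have hdet : ∀ x : Fin K → ℝ, ∑ κ ∈ s, (c κ - d κ) / hypNorm a ε κ *
      (Matrix.of fun i j : Fin K => (hypPoly a ε (κ.shifted i)).eval (x j)).det = 0 := by
    intro x
    have h1 := congrArg (MvPolynomial.aeval x) h0
    rw [map_sum, map_zero] at h1
    rw [← h1]
    refine Finset.sum_congr rfl fun κ _ => ?_
    rw [map_mul, mvDet, AlgHom.map_det, MvPolynomial.algHom_C]
    congr 2
    ext i j
    simp only [AlgHom.mapMatrix_apply, Matrix.map_apply, Matrix.of_apply]
    rw [← Polynomial.aeval_algHom_apply, MvPolynomial.aeval_X, coe_aeval_eq_eval]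
  have hz := eq_zero_of_sum_det_eq_zero (fun k x => (hypPoly a ε k).eval x)
    (fun R => ⟨fun j => (j : ℕ), by
      have h := det_aeval_of_natDegree (hypPoly a ε) (hypPoly_ne_zero ha hε)
        (natDegree_hypPoly ha hε) (fun j : Fin R => ((j : ℕ) : ℝ))
      simp only [coe_aeval_eq_eval] at h
      rw [h]
      refine mul_ne_zero ?_ (Matrix.det_vandermonde_ne_zero_iff.2 fun i j hij => ?_)
      · simpa using Finset.prod_ne_zero_iff.2 fun (i : Fin R) _ =>
          leadingCoeff_ne_zero.2 (hypPoly_ne_zero ha hε i)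
      · exact Fin.ext (by exact_mod_cast hij)⟩) s _ hdet
  ext κ
  by_cases hκ : κ ∈ s
  · have := hz κ hκ
    rw [div_eq_zero_iff] at this
    exact sub_eq_zero.1 (this.resolve_right (hypNorm_ne_zero ha hε κ))
  · rw [hs, Finset.mem_union, not_or] at hκ
    rw [hc0 κ hκ.1, hd0 κ hκ.2]

theorem isJacobiExpansion_jacobiLambda (ha : -1 < a) (hb : -1 < b) (hε : 0 ≤ ε)
    (hab : ε = (a + b + 1) / 2) (ν : PosSignature (K + M)) :
    IsJacobiExpansion a b ν (jacobiLambda a b ν : PosSignature K → ℝ) := by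
  have h := exists_isJacobiExpansion (K := K) ha hb hε hab ν
  rw [jacobiLambda, dif_pos h]
  exact h.choose_spec

/-- This trivial row later determines the constant in the Cauchy identity. -/
theorem isJacobiExpansion_zero (ha : -1 < a) (hb : -1 < b) (hε : 0 ≤ ε)
    (hab : ε = (a + b + 1) / 2) [DecidableEq (PosSignature K)] :
    IsJacobiExpansion a b (0 : PosSignature (K + M)) (Pi.single (0 : PosSignature K) 1) := by
  have hsupp : (Pi.single (0 : PosSignature K) (1 : ℝ) : PosSignature K → ℝ).support = {0} := by
    ext κ
    simp
  refine (isJacobiExpansion_iff _ _).2 ⟨by rw [hsupp]; exact Set.finite_singleton _, ?_⟩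
  simp only [hsupp, Set.Finite.toFinset_singleton, Finset.sum_singleton, Pi.single_eq_same,
    map_one, one_mul]
  rw [jacobiY_zero ha hb hε hab, jacobiY_zero ha hb hε hab, map_one]

theorem mvFunctional_mvVandermonde_mul_jacobiY {A : Type*} [CommRing A] [Algebra ℝ A] {N : ℕ}
    (ha : -1 < a) (hb : -1 < b) (hε : 0 ≤ ε) (hab : ε = (a + b + 1) / 2) (ν : PosSignature N)
    (φ : Fin N → ℕ → A) :
    mvFunctional ℝ φ (mvVandermonde ℝ N * jacobiY a b ν) = (hypNorm a ε ν)⁻¹ •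
      (Matrix.of fun i j : Fin N => polyFunctional ℝ (φ j) (hypPoly a ε (ν.shifted i))).det := by
  rw [← mvFunctional_det φ fun i _ => hypPoly a ε (ν.shifted i), ← mvDet,
    ← mvVandermonde_mul_jacobiY ha hb hε hab ν, ← MvPolynomial.smul_eq_C_mul, map_smul, smul_smul,
    inv_mul_cancel₀ (hypNorm_ne_zero ha hε ν), one_smul]

/-- The expansion of the specialized Jacobi polynomial, tested against product functionals. -/
theorem det_extendFunctional_hypPoly {A : Type*} [CommRing A] [Algebra ℝ A]
    (ha : -1 < a) (hb : -1 < b) (hε : 0 ≤ ε) (hab : ε = (a + b + 1) / 2)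
    (ν : PosSignature (K + M)) {c : PosSignature K → ℝ} (hc : c.support.Finite)
    (h : IsJacobiExpansion a b ν c) (φ : Fin K → ℕ → A) :
    ((blockSign K M : ℤ) : A) * ((hypNorm a ε ν)⁻¹ • (Matrix.of fun i j : Fin (K + M) =>
      polyFunctional ℝ (extendFunctional M φ j) (hypPoly a ε (ν.shifted i))).det) =
    ∑ κ ∈ hc.toFinset, (c κ * (hypNorm a ε κ)⁻¹) • (Matrix.of fun i j : Fin K =>
      polyFunctional ℝ (φ j) (hypPoly a ε (κ.shifted i))).det := by
  obtain ⟨hc', h⟩ := (isJacobiExpansion_iff ν c).1 h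
  rw [← mvFunctional_mvVandermonde_mul_jacobiY ha hb hε hab, mvFunctional_specializeZeros, h,
    Finset.mul_sum, map_sum]
  refine Finset.sum_congr rfl fun κ _ => ?_
  rw [mul_left_comm, ← MvPolynomial.smul_eq_C_mul, map_smul,
    mvFunctional_mvVandermonde_mul_jacobiY ha hb hε hab, smul_smul]

end expansion

/-! ### The Cauchy functional and the functions `g_k` -/

section identity

variable {a b ε : ℝ} {K M : ℕ}

/-- A finite telescoping sum. At the node `x = u (M + D)` the remainder vanishes and a closed form
is left. -/
theorem sum_newtonProd_mul_prod_inv {F : Type*} [Field F] (u : ℕ → F) (x T : F) (M D : ℕ)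
    (hT : ∀ l, T ≠ u (M + 1 + l)) :
    (T - x) * ∑ d ∈ Finset.range (D + 1), newtonProd u (M + d) x *
        ∏ l ∈ Finset.range d, (T - u (M + 1 + l))⁻¹ =
      newtonProd u M x * (T - u M) -
        newtonProd u (M + D + 1) x * ∏ l ∈ Finset.range D, (T - u (M + 1 + l))⁻¹ := by
  induction D with
  | zero => simp [newtonProd_succ]; ring
  | succ D ih =>
    rw [Finset.sum_range_succ, mul_add, ih, newtonProd_succ _ (M + (D + 1)), ← add_assoc,
      Finset.prod_range_succ, add_right_comm M 1 D]
    have h : T - u (M + D + 1) ≠ 0 := sub_ne_zero.2 (by rw [add_right_comm]; exact hT D)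
    field_simp
    ring

theorem newtonProd_ofReal (m : ℕ) (x : ℝ) :
    newtonProd (fun l => (node ε l : ℂ)) m (x : ℂ) = (newtonProd (node ε) m x : ℝ) := by
  simp [newtonProd]

/-- The functional that transforms `₂F₁` polynomials into the functions `g_k`. -/
def cauchyFunctional (a ε : ℝ) (M : ℕ) (T : ℂ) (e : ℕ) : ℂ :=
  ((hypCoeff a (M + e))⁻¹ : ℝ) * ∏ l ∈ Finset.range e, (T - node ε (M + 1 + l))⁻¹

/-- The coefficients of `g_k` in the functions `∏_{l<m} (t² - (L+l+ε)²)⁻¹`. -/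
def gCoeff (a ε : ℝ) (M k m : ℕ) : ℝ :=
  newtonProd (node ε) m (node ε k) * (hypCoeff a m * hypCoeff a M / hypCoeff a (M + m))

/-- The function `g_k` as a function of `T = t²`. -/
def gSq (a ε : ℝ) (M k : ℕ) (T : ℂ) : ℂ :=
  ∑ m ∈ Finset.range (k + 1), (gCoeff a ε M k m : ℂ) *
    ∏ l ∈ Finset.range m, (T - node ε (M + 1 + l))⁻¹

theorem hypCoeff_add (ha : -1 < a) (M m : ℕ) :
    hypCoeff a (M + m) * ((ascPochhammer ℝ m).eval ((M : ℝ) + 1) *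
      (ascPochhammer ℝ m).eval ((M : ℝ) + 1 + a)) = hypCoeff a M * (-1) ^ m := by
  induction m with
  | zero => simp
  | succ m ih =>
    rw [ascPochhammer_succ_eval, ascPochhammer_succ_eval, pow_succ, ← mul_assoc (hypCoeff a M), ← ih]
    have h := hypCoeff_succ ha (M + m)
    rw [← add_assoc]
    push_cast at h
    linear_combination ((ascPochhammer ℝ m).eval ((M : ℝ) + 1) *
      (ascPochhammer ℝ m).eval ((M : ℝ) + 1 + a)) * h

theorem ascPochhammer_eval_eq_prod {R : Type*} [CommRing R] (m : ℕ) (x : R) :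
    (ascPochhammer R m).eval x = ∏ l ∈ Finset.range m, (x + l) := by
  induction m with
  | zero => simp
  | succ m ih => rw [ascPochhammer_succ_eval, ih, Finset.prod_range_succ]

theorem ascPochhammer_eval_ofReal (m : ℕ) (x : ℝ) :
    (ascPochhammer ℂ m).eval (x : ℂ) = ((ascPochhammer ℝ m).eval x : ℝ) := by
  rw [ascPochhammer_eval_eq_prod, ascPochhammer_eval_eq_prod]
  push_cast
  rfl

/-- The Pochhammer factors pair up: `(-k + l)(k + 2ε + l)` is minus a difference of nodes, and the
two `t`-dependent lower parameters combine into `t ^ 2` minus a node. The factors `(L)_m (L + a)_m`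
are a ratio of values of `hypCoeff`. -/
theorem gFun_eq_gSq (ha : -1 < a) (M k : ℕ) (t : ℂ) :
    gFun a ε (M + 1) k t = gSq a ε M k (t ^ 2) := by
  rw [gFun, terminating4F3, gSq]
  refine Finset.sum_congr rfl fun m _ => ?_
  have h1 : (ascPochhammer ℂ m).eval (-(k : ℂ)) * (ascPochhammer ℂ m).eval ((k : ℂ) + 2 * (ε : ℂ)) =
      (-1) ^ m * (newtonProd (node ε) m (node ε k) : ℝ) := by
    rw [ascPochhammer_eval_eq_prod, ascPochhammer_eval_eq_prod,
      ← Finset.prod_mul_distrib, newtonProd, ← Finset.card_range m, ← Finset.prod_const,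
      Finset.card_range, Complex.ofReal_prod, ← Finset.prod_mul_distrib]
    refine Finset.prod_congr rfl fun l _ => ?_
    simp only [node]
    push_cast
    ring
  have h2 : (ascPochhammer ℂ m).eval (-t + ((M + 1 : ℕ) : ℂ) + (ε : ℂ)) *
      (ascPochhammer ℂ m).eval (t + ((M + 1 : ℕ) : ℂ) + (ε : ℂ)) =
      (-1) ^ m * ∏ l ∈ Finset.range m, (t ^ 2 - node ε (M + 1 + l)) := by
    rw [ascPochhammer_eval_eq_prod, ascPochhammer_eval_eq_prod,
      ← Finset.prod_mul_distrib, ← Finset.card_range m, ← Finset.prod_const,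
      Finset.card_range, ← Finset.prod_mul_distrib]
    refine Finset.prod_congr rfl fun l _ => ?_
    simp only [node]
    push_cast
    ring
  have h3 : (ascPochhammer ℂ m).eval (((M + 1 : ℕ) : ℂ)) *
      (ascPochhammer ℂ m).eval (((M + 1 : ℕ) : ℂ) + (a : ℂ)) =
      ((hypCoeff a M * (-1) ^ m / hypCoeff a (M + m) : ℝ) : ℂ) := by
    rw [← hypCoeff_add ha M m, mul_div_cancel_left₀ _ (hypCoeff_ne_zero ha _), Complex.ofReal_mul,
      ← ascPochhammer_eval_ofReal, ← ascPochhammer_eval_ofReal]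
    push_cast
    rfl
  have h4 : (ascPochhammer ℂ m).eval ((a : ℂ) + 1) * (m.factorial : ℂ) =
      (((-1) ^ m / hypCoeff a m : ℝ) : ℂ) := by
    have hp := (ascPochhammer_pos m (a + 1) (by linarith)).ne'
    have hm : (m.factorial : ℝ) ≠ 0 := by exact_mod_cast m.factorial_ne_zero
    have h5 : (-1) ^ m / hypCoeff a m = (ascPochhammer ℝ m).eval (a + 1) * (m.factorial : ℝ) := by
      rw [hypCoeff]
      field_simp
    rw [h5, Complex.ofReal_mul, ← ascPochhammer_eval_ofReal]
    push_cast
    rfl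
  rw [h1, mul_assoc _ _ ((ascPochhammer ℂ m).eval (((M + 1 : ℕ) : ℂ) + (a : ℂ))), h3, h2,
    mul_assoc _ _ (m.factorial : ℂ), h4, gCoeff, Finset.prod_inv_distrib]
  have hm1 : ((-1 : ℂ)) ^ m ≠ 0 := pow_ne_zero _ (by norm_num)
  have hc1 : (hypCoeff a (M + m) : ℂ) ≠ 0 := by exact_mod_cast hypCoeff_ne_zero ha (M + m)
  have hc2 : (hypCoeff a m : ℂ) ≠ 0 := by exact_mod_cast hypCoeff_ne_zero ha m
  push_cast
  -- At a pole both terms are zero because `0⁻¹ = 0`, so no regularity of `t` is needed.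
  by_cases hz : ∏ l ∈ Finset.range m, (t ^ 2 - (node ε (M + 1 + l) : ℂ)) = 0
  · simp [hz]
  · field_simp

theorem polyFunctional_cauchyFunctional (ha : -1 < a) (hε : 0 ≤ ε) (M k : ℕ) (T : ℂ) :
    polyFunctional ℝ (cauchyFunctional a ε M T) (hypPoly a ε k) =
      ((hypCoeff a M)⁻¹ : ℝ) * gSq a ε M k T := by
  rw [polyFunctional_hypPoly ha hε, gSq, Finset.mul_sum]
  refine Finset.sum_congr rfl fun m _ => ?_
  have h1 : (hypCoeff a M : ℂ) ≠ 0 := by exact_mod_cast hypCoeff_ne_zero ha M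
  rw [Complex.real_smul, cauchyFunctional, gCoeff]
  push_cast
  field_simp

/-- The factor `(hypCoeff a (M + e))⁻¹` in the functional cancels the coefficient of the polynomial,
leaving the telescoping sum. For `n < M` both sides vanish. -/
theorem polyFunctional_shifted_cauchyFunctional (ha : -1 < a) (hε : 0 ≤ ε) (M n : ℕ) (T : ℂ)
    (hT : ∀ l, T ≠ node ε (M + 1 + l)) (hTn : T ≠ node ε n) :
    polyFunctional ℝ (fun e => if M ≤ e then cauchyFunctional a ε M T (e - M) else 0)
      (hypPoly a ε n) =
    (T - node ε M) * (newtonProd (fun l => (node ε l : ℂ)) M (node ε n) / (T - node ε n)) := by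
  rw [polyFunctional_hypPoly ha hε]
  by_cases hn : n < M
  · rw [newtonProd_node_eq_zero _ hn, zero_div, mul_zero]
    refine Finset.sum_eq_zero fun m hm => ?_
    rw [Finset.mem_range] at hm
    rw [if_neg (by omega), smul_zero]
  · obtain ⟨D, rfl⟩ := Nat.exists_eq_add_of_le (not_lt.1 hn)
    have h := sum_newtonProd_mul_prod_inv (fun l => (node ε l : ℂ)) (node ε (M + D)) T M D hT
    rw [newtonProd_node_eq_zero (fun l => (node ε l : ℂ)) (Nat.lt_succ_self (M + D)), zero_mul,
      sub_zero] at h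
    have hne : T - (node ε (M + D) : ℂ) ≠ 0 := sub_ne_zero.2 hTn
    rw [add_assoc M D 1, Finset.sum_range_add, Finset.sum_eq_zero, zero_add, mul_div_assoc',
      eq_div_iff hne, mul_comm, mul_comm (T - _) (newtonProd _ _ _), ← h]
    · congr 1
      refine Finset.sum_congr rfl fun d _ => ?_
      rw [if_pos (Nat.le_add_right M d), Nat.add_sub_cancel_left, Complex.real_smul,
        cauchyFunctional, newtonProd_ofReal]
      have h1 : (hypCoeff a (M + d) : ℂ) ≠ 0 := by exact_mod_cast hypCoeff_ne_zero ha (M + d)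
      push_cast
      field_simp
    · intro m hm
      rw [Finset.mem_range] at hm
      rw [if_neg (by omega), smul_zero]

theorem det_extendFunctional_cauchyFunctional (ha : -1 < a) (hε : 0 ≤ ε) (n : Fin (K + M) → ℕ)
    (T : Fin K → ℂ) (hT : ∀ j l, T j ≠ node ε (M + 1 + l)) (hTn : ∀ j i, T j ≠ node ε (n i)) :
    (Matrix.of fun i j : Fin (K + M) => polyFunctional ℝ
      (extendFunctional M (fun j => cauchyFunctional a ε M (T j)) j) (hypPoly a ε (n i))).det =
    (∏ j, (T j - node ε M)) * (∏ m : Fin M, (hypCoeff a m : ℂ)) *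
      (Matrix.of fun i j : Fin (K + M) =>
        (Fin.append (fun j : Fin K =>
            newtonProd (fun l => (node ε l : ℂ)) M (node ε (n i)) / (T j - node ε (n i)))
          (fun m : Fin M => newtonProd (fun l => (node ε l : ℂ)) m (node ε (n i))) :
            Fin (K + M) → ℂ) j).det := by
  have h := Matrix.det_mul_row (Fin.append (fun j : Fin K => T j - (node ε M : ℂ))
    (fun m : Fin M => (hypCoeff a m : ℂ))) (Matrix.of fun i j : Fin (K + M) =>
        (Fin.append (fun j : Fin K =>
            newtonProd (fun l => (node ε l : ℂ)) M (node ε (n i)) / (T j - node ε (n i)))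
          (fun m : Fin M => newtonProd (fun l => (node ε l : ℂ)) m (node ε (n i))) :
            Fin (K + M) → ℂ) j)
  rw [Fin.prod_univ_add] at h
  simp only [Fin.append_left, Fin.append_right] at h
  rw [← h]
  congr 1
  ext1 i j
  refine Fin.addCases (fun j => ?_) (fun m => ?_) j
  · simp only [Matrix.of_apply, Fin.append_left, extendFunctional]
    exact polyFunctional_shifted_cauchyFunctional ha hε M (n i) (T j) (hT j) (hTn j i)
  · simp only [Matrix.of_apply, Fin.append_right, extendFunctional]
    rw [polyFunctional_hypPoly_coeff ha hε, newtonProd_ofReal]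
    simp

/-- The Cauchy-type identity up to a constant that does not depend on the signature. -/
theorem exists_cauchy_identity (ha : -1 < a) (hb : -1 < b) (hε : 0 ≤ ε)
    (hab : ε = (a + b + 1) / 2) (K M : ℕ) :
    ∃ Θ : ℂ, ∀ (ν : PosSignature (K + M)) (c : PosSignature K → ℝ) (hc : c.support.Finite),
      IsJacobiExpansion a b ν c → ∀ T : Fin K → ℂ, Function.Injective T →
      (∀ j l, T j ≠ node ε (M + 1 + l)) → (∀ j i, T j ≠ node ε (ν.shifted i)) →
      Θ * (Matrix.vandermonde T).det *
          ∏ j, newtonProd (fun l => (node ε l : ℂ)) (M + 1) (T j) =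
        (∑ κ ∈ hc.toFinset,
          ((c κ / (Matrix.vandermonde fun i => node ε (κ.shifted i)).det : ℝ) : ℂ) *
            (Matrix.of fun i j : Fin K => gSq a ε M (κ.shifted i) (T j)).det) *
          ∏ j, ∏ i, (T j - node ε (ν.shifted i)) := by
  obtain ⟨θ, hθ⟩ := exists_cauchyVandermonde (fun l => (node ε l : ℂ)) K M
  set Z : ℕ → ℂ := fun n => ∏ j : Fin n, (hypCoeff a j : ℂ) with hZ
  have hZ0 : ∀ n, Z n ≠ 0 := fun n => Finset.prod_ne_zero_iff.2 fun j _ => by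
    exact_mod_cast hypCoeff_ne_zero ha j
  have hM0 : (hypCoeff a M : ℂ) ≠ 0 := by exact_mod_cast hypCoeff_ne_zero ha M
  -- No factor depends on the signature: `Z (K + M)` and `Z K` come from the `hypNorm` on the two
  -- sides, `Z M` from the coefficient columns and the power of `hypCoeff a M` from the `g_k`. The
  -- Vandermonde determinant of `ν` in `hypNorm` cancels the one from `hθ`.
  refine ⟨((blockSign K M : ℤ) : ℂ) * (Z (K + M))⁻¹ * Z M * θ * Z K * (hypCoeff a M : ℂ) ^ K,
    fun ν c hc h T hT hTl hTn => ?_⟩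
  have h1 := det_extendFunctional_hypPoly ha hb hε hab ν hc h
    fun j => cauchyFunctional a ε M (T j)
  rw [det_extendFunctional_cauchyFunctional ha hε ν.shifted T hTl hTn] at h1
  have h2 := hθ (fun i => (node ε (ν.shifted i) : ℂ)) T hT (fun i j => hTn j i)
  have h3 : (Matrix.vandermonde fun i => (node ε (ν.shifted i) : ℂ)).det =
      ((Matrix.vandermonde fun i => node ε (ν.shifted i)).det : ℝ) := by
    simp [Matrix.det_vandermonde]
  have hv : ((Matrix.vandermonde fun i => node ε (ν.shifted i)).det : ℂ) ≠ 0 := by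
    exact_mod_cast vandermonde_node_ne_zero hε ν
  have h4 : ∀ κ : PosSignature K, (Matrix.of fun i j : Fin K =>
      polyFunctional ℝ (cauchyFunctional a ε M (T j)) (hypPoly a ε (κ.shifted i))).det =
      ((hypCoeff a M : ℂ) ^ K)⁻¹ *
        (Matrix.of fun i j : Fin K => gSq a ε M (κ.shifted i) (T j)).det := by
    intro κ
    have := Matrix.det_mul_row (fun _ : Fin K => (((hypCoeff a M)⁻¹ : ℝ) : ℂ))
      (Matrix.of fun i j : Fin K => gSq a ε M (κ.shifted i) (T j))
    simp only [polyFunctional_cauchyFunctional ha hε]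
    simp only [Matrix.of_apply] at this
    rw [this]
    simp
  have h5 : ∑ κ ∈ hc.toFinset,
      ((c κ / (Matrix.vandermonde fun i => node ε (κ.shifted i)).det : ℝ) : ℂ) *
        (Matrix.of fun i j : Fin K => gSq a ε M (κ.shifted i) (T j)).det =
      Z K * (hypCoeff a M : ℂ) ^ K * ∑ κ ∈ hc.toFinset, (c κ * (hypNorm a ε κ)⁻¹) •
        (Matrix.of fun i j : Fin K =>
          polyFunctional ℝ (cauchyFunctional a ε M (T j)) (hypPoly a ε (κ.shifted i))).det := by
    rw [Finset.mul_sum]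
    refine Finset.sum_congr rfl fun κ _ => ?_
    rw [h4, Complex.real_smul, hypNorm]
    have hk : (∏ j : Fin K, (hypCoeff a j : ℂ)) ≠ 0 := hZ0 K
    simp only [hZ]
    push_cast
    field_simp
  rw [h5, ← h1, Complex.real_smul, hypNorm]
  have h6 : ∏ j, newtonProd (fun l => (node ε l : ℂ)) (M + 1) (T j) =
      (∏ j, newtonProd (fun l => (node ε l : ℂ)) M (T j)) * ∏ j, (T j - node ε M) := by
    rw [← Finset.prod_mul_distrib]
    simp only [newtonProd_succ]
  rw [h6]
  rw [h3] at h2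
  have hk : (∏ j : Fin (K + M), (hypCoeff a j : ℂ)) ≠ 0 := hZ0 (K + M)
  have h7 : ∀ A : ℂ, Z K * (hypCoeff a M : ℂ) ^ K * (((blockSign K M : ℤ) : ℂ) *
      (((((∏ j : Fin (K + M), hypCoeff a j) *
        (Matrix.vandermonde fun i => node ε (ν.shifted i)).det)⁻¹ : ℝ) : ℂ) *
        ((∏ j, (T j - node ε M)) * (∏ m : Fin M, (hypCoeff a m : ℂ)) * A))) *
        ∏ j, ∏ i, (T j - node ε (ν.shifted i)) =
      Z K * (hypCoeff a M : ℂ) ^ K * ((blockSign K M : ℤ) : ℂ) * (Z (K + M))⁻¹ * Z M *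
        (∏ j, (T j - node ε M)) * ((Matrix.vandermonde fun i => node ε (ν.shifted i)).det : ℂ)⁻¹ *
        (A * ∏ j, ∏ i, (T j - node ε (ν.shifted i))) := by
    intro A
    simp only [hZ]
    push_cast
    rw [mul_inv]
    ring
  rw [h7, h2]
  field_simp

end identity

/-! ### The constant, regular points and uniqueness -/

section main

variable {a b ε : ℝ} {K M : ℕ}

theorem gCoeff_self_ne_zero (ha : -1 < a) (hε : 0 ≤ ε) (M k : ℕ) : gCoeff a ε M k k ≠ 0 :=
  mul_ne_zero (newtonProd_node_self_ne_zero hε k)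
    (div_ne_zero (mul_ne_zero (hypCoeff_ne_zero ha k) (hypCoeff_ne_zero ha M))
      (hypCoeff_ne_zero ha (M + k)))

theorem prod_gCoeff_ne_zero (ha : -1 < a) (hε : 0 ≤ ε) (M R : ℕ) :
    ∏ i : Fin R, (gCoeff a ε M i i : ℂ) ≠ 0 :=
  Finset.prod_ne_zero_iff.2 fun i _ => by exact_mod_cast gCoeff_self_ne_zero ha hε M i

theorem det_gSq {R : ℕ} (T : Fin R → ℂ) (hT : ∀ j l, T j ≠ node ε (M + 1 + l)) :
    (Matrix.of fun i j : Fin R => gSq a ε M i (T j)).det =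
    (∏ i : Fin R, (gCoeff a ε M i i : ℂ)) *
      ((Equiv.Perm.sign (Fin.revPerm : Equiv.Perm (Fin R)) : ℤ) : ℂ) *
      (Matrix.vandermonde T).det *
        ∏ j, ∏ l ∈ Finset.range (R - 1), (T j - node ε (M + 1 + l))⁻¹ :=
  det_sum_prod_inv (fun l => (node ε (M + 1 + l) : ℂ)) (fun k m => (gCoeff a ε M k m : ℂ)) T hT

theorem det_gSq_ne_zero (ha : -1 < a) (hε : 0 ≤ ε) {R : ℕ} (T : Fin R → ℂ)
    (hT : ∀ j l, T j ≠ node ε (M + 1 + l)) (hinj : Function.Injective T) :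
    (Matrix.of fun i j : Fin R => gSq a ε M i (T j)).det ≠ 0 := by
  rw [det_gSq T hT]
  refine mul_ne_zero (mul_ne_zero (mul_ne_zero (prod_gCoeff_ne_zero ha hε M R) ?_)
    (Matrix.det_vandermonde_ne_zero_iff.2 hinj)) ?_
  · exact_mod_cast (Equiv.Perm.sign (Fin.revPerm : Equiv.Perm (Fin R))).ne_zero
  · exact Finset.prod_ne_zero_iff.2 fun j _ => Finset.prod_ne_zero_iff.2 fun l _ =>
      inv_ne_zero (sub_ne_zero.2 (hT j l))

theorem det_gSq_rev (T : Fin K → ℂ) :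
    (Matrix.of fun i j : Fin K => gSq a ε M (i.rev : ℕ) (T j)).det =
      ((Equiv.Perm.sign (Fin.revPerm : Equiv.Perm (Fin K)) : ℤ) : ℂ) *
        (Matrix.of fun i j : Fin K => gSq a ε M i (T j)).det := by
  rw [← Matrix.det_permute]
  rfl

theorem det_gSq_rev_ne_zero (ha : -1 < a) (hε : 0 ≤ ε) (T : Fin K → ℂ)
    (hT : ∀ j l, T j ≠ node ε (M + 1 + l)) (hinj : Function.Injective T) :
    (Matrix.of fun i j : Fin K => gSq a ε M (i.rev : ℕ) (T j)).det ≠ 0 := by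
  rw [det_gSq_rev]
  refine mul_ne_zero ?_ (det_gSq_ne_zero ha hε T hT hinj)
  exact_mod_cast (Equiv.Perm.sign (Fin.revPerm : Equiv.Perm (Fin K))).ne_zero

theorem det_gSq_rev_eq (T : Fin K → ℂ) (hT : ∀ j l, T j ≠ node ε (M + 1 + l)) :
    (Matrix.of fun i j : Fin K => gSq a ε M (i.rev : ℕ) (T j)).det =
      (∏ i : Fin K, (gCoeff a ε M i i : ℂ)) * (Matrix.vandermonde T).det *
        ∏ j, ∏ l ∈ Finset.range (K - 1), (T j - node ε (M + 1 + l))⁻¹ := by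
  rw [det_gSq_rev, det_gSq T hT]
  have h : ((Equiv.Perm.sign (Fin.revPerm : Equiv.Perm (Fin K)) : ℤ) : ℂ) *
      ((Equiv.Perm.sign (Fin.revPerm : Equiv.Perm (Fin K)) : ℤ) : ℂ) = 1 := by
    rw [← Int.cast_mul, ← Units.val_mul]
    simp
  linear_combination ((∏ i : Fin K, (gCoeff a ε M i i : ℂ)) * (Matrix.vandermonde T).det *
    ∏ j, ∏ l ∈ Finset.range (K - 1), (T j - node ε (M + 1 + l))⁻¹) * h

theorem sigCharFun_eq {N : ℕ} (ν : PosSignature N) (t : ℂ) :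
    sigCharFun ε ν t = newtonProd (fun l => (node ε l : ℂ)) N (t ^ 2) /
      ∏ i, (t ^ 2 - node ε (ν.shifted i)) := by
  rw [sigCharFun, Finset.prod_div_distrib]
  congr 1
  · rw [newtonProd, Finset.prod_range, ← Equiv.prod_comp Fin.revPerm]
    simp [node]
  · simp [node]

theorem sigDim_eq (κ : PosSignature K) :
    sigDim ε κ = (Matrix.vandermonde fun i => node ε (κ.shifted i)).det /
      (Matrix.vandermonde fun i => node ε ((0 : PosSignature K).shifted i)).det := by
  rw [sigDim, Matrix.det_vandermonde, Matrix.det_vandermonde, ← Finset.prod_div_distrib]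
  refine Finset.prod_congr rfl fun i _ => ?_
  rw [← Finset.prod_div_distrib]
  refine Finset.prod_congr rfl fun j _ => ?_
  -- The Vandermonde determinant has the differences in the opposite order; the signs cancel in the
  -- quotient.
  rw [← neg_div_neg_eq, neg_sub, neg_sub]
  simp only [node, PosSignature.zero_shifted]

theorem sigDim_ne_zero (hε : 0 ≤ ε) (κ : PosSignature K) : sigDim ε κ ≠ 0 := by
  rw [sigDim_eq]
  exact div_ne_zero (vandermonde_node_ne_zero hε _) (vandermonde_node_ne_zero hε _)

theorem sigCharFun_zero {N : ℕ} (t : ℂ) (ht : ∀ l, t ^ 2 ≠ node ε l) :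
    sigCharFun ε (0 : PosSignature N) t = 1 := by
  refine Finset.prod_eq_one fun i _ => ?_
  rw [PosSignature.zero_shifted, div_self]
  refine sub_ne_zero.2 ?_
  simpa [node] using ht (i.rev : ℕ)

theorem isRegularPoint_iff {N : ℕ} (ν : PosSignature N) (t : Fin K → ℂ) :
    IsRegularPoint ε (M + 1) ν t ↔ (∀ j i, t j ^ 2 ≠ node ε (ν.shifted i)) ∧
      (∀ j l, t j ^ 2 ≠ node ε (M + 1 + l)) ∧ Function.Injective fun j => t j ^ 2 := by
  rw [IsRegularPoint]
  have h1 : ∀ n : ℕ, ((n : ℂ) + (ε : ℂ)) ^ 2 = node ε n := fun n => by simp [node]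
  have h2 : ∀ l : ℕ, (((M + 1 : ℕ) : ℂ) + (ε : ℂ) + (l : ℂ)) ^ 2 = node ε (M + 1 + l) := fun l => by
    simp only [node]
    push_cast
    ring
  simp only [h1, h2]

theorem schurG_eq (ha : -1 < a) (κ : PosSignature K) (t : Fin K → ℂ) :
    schurG a ε (M + 1) κ t = (Matrix.of fun i j : Fin K => gSq a ε M (κ.shifted i) (t j ^ 2)).det /
      (Matrix.of fun i j : Fin K => gSq a ε M (i.rev : ℕ) (t j ^ 2)).det := by
  simp only [schurG, gFun_eq_gSq ha]

theorem I_mul_sq_ne_node (ε : ℝ) (n l : ℕ) : (Complex.I * ((n : ℂ) + 1)) ^ 2 ≠ node ε l := by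
  rw [mul_pow, Complex.I_sq]
  intro h
  have h2 : -1 * ((n : ℝ) + 1) ^ 2 = node ε l := by exact_mod_cast h
  have h3 : 0 ≤ node ε l := sq_nonneg _
  have h4 : 0 < ((n : ℝ) + 1) ^ 2 := by positivity
  linarith

theorem I_mul_sq_injective : Function.Injective fun n : ℕ => (Complex.I * ((n : ℂ) + 1)) ^ 2 := by
  intro n m h
  simp only [mul_pow, Complex.I_sq] at h
  have h2 : -1 * ((n : ℝ) + 1) ^ 2 = -1 * ((m : ℝ) + 1) ^ 2 := by exact_mod_cast h
  have h3 : ((n : ℝ) + 1) = m + 1 := by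
    rw [← sq_eq_sq₀ (by positivity) (by positivity)]
    linarith
  exact_mod_cast add_right_cancel h3

/-- Squares of nonzero imaginary numbers are negative while the nodes are nonnegative, so these
points are regular for every `ν`. -/
theorem isRegularPoint_I_mul {N : ℕ} (ν : PosSignature N) {n : Fin K → ℕ}
    (hn : Function.Injective n) :
    IsRegularPoint ε (M + 1) ν fun j => Complex.I * ((n j : ℂ) + 1) :=
  (isRegularPoint_iff ν _).2 ⟨fun j _ => I_mul_sq_ne_node ε (n j) _,
    fun j _ => I_mul_sq_ne_node ε (n j) _, I_mul_sq_injective.comp hn⟩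

/-- The identity cleared of denominators, up to a constant. -/
theorem exists_prod_sigCharFun_mul_det (ha : -1 < a) (hb : -1 < b) (hε : 0 ≤ ε)
    (hab : ε = (a + b + 1) / 2) (hK : 1 ≤ K) :
    ∃ Θ : ℂ, ∀ (ν : PosSignature (K + M)) (c : PosSignature K → ℝ) (hc : c.support.Finite),
      IsJacobiExpansion a b ν c → ∀ t : Fin K → ℂ, IsRegularPoint ε (M + 1) ν t →
      Θ * ((∏ j, sigCharFun ε ν (t j)) *
        (Matrix.of fun i j : Fin K => gSq a ε M (i.rev : ℕ) (t j ^ 2)).det) =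
      ∑ κ ∈ hc.toFinset,
        ((c κ / (Matrix.vandermonde fun i => node ε (κ.shifted i)).det : ℝ) : ℂ) *
          (Matrix.of fun i j : Fin K => gSq a ε M (κ.shifted i) (t j ^ 2)).det := by
  obtain ⟨Θ, hΘ⟩ := exists_cauchy_identity ha hb hε hab K M
  set G := ∏ i : Fin K, (gCoeff a ε M i i : ℂ) with hG
  have hG0 : G ≠ 0 := prod_gCoeff_ne_zero ha hε M K
  refine ⟨Θ / G, fun ν c hc h t ht => ?_⟩
  obtain ⟨h1, h2, h3⟩ := (isRegularPoint_iff ν t).1 ht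
  have h4 := hΘ ν c hc h (fun j => t j ^ 2) h3 h2 h1
  have hD : ∏ j, ∏ i, (t j ^ 2 - (node ε (ν.shifted i) : ℂ)) ≠ 0 :=
    Finset.prod_ne_zero_iff.2 fun j _ => Finset.prod_ne_zero_iff.2 fun i _ =>
      sub_ne_zero.2 (h1 j i)
  refine mul_right_cancel₀ hD (Eq.trans ?_ h4)
  rw [det_gSq_rev_eq _ h2, ← hG]
  simp only [sigCharFun_eq, Finset.prod_div_distrib]
  -- The `K - 1` extra factors are exactly the common denominator of `det [g_{K-i}]`; since `1 ≤ K`,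
  -- `M + 1 + (K - 1) = K + M`.
  have h5 : ∀ j, newtonProd (fun l => (node ε l : ℂ)) (K + M) (t j ^ 2) =
      newtonProd (fun l => (node ε l : ℂ)) (M + 1) (t j ^ 2) *
        ∏ l ∈ Finset.range (K - 1), (t j ^ 2 - node ε (M + 1 + l)) := by
    intro j
    rw [newtonProd, newtonProd, ← Finset.prod_range_add, show M + 1 + (K - 1) = K + M by omega]
  simp only [h5, Finset.prod_mul_distrib, Finset.prod_inv_distrib]
  have hE : ∏ j, ∏ l ∈ Finset.range (K - 1), (t j ^ 2 - (node ε (M + 1 + l) : ℂ)) ≠ 0 :=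
    Finset.prod_ne_zero_iff.2 fun j _ => Finset.prod_ne_zero_iff.2 fun l _ =>
      sub_ne_zero.2 (h2 j l)
  field_simp

theorem prod_sigCharFun_eq_sum (ha : -1 < a) (hb : -1 < b) (hε : 0 ≤ ε)
    (hab : ε = (a + b + 1) / 2) (hK : 1 ≤ K) (ν : PosSignature (K + M)) {c : PosSignature K → ℝ}
    (hc : c.support.Finite) (h : IsJacobiExpansion a b ν c) {t : Fin K → ℂ}
    (ht : IsRegularPoint ε (M + 1) ν t) :
    ∏ j, sigCharFun ε ν (t j) =
      ∑ κ ∈ hc.toFinset, ((c κ / sigDim ε κ : ℝ) : ℂ) * schurG a ε (M + 1) κ t := by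
  classical
  obtain ⟨Θ, hΘ⟩ := exists_prod_sigCharFun_mul_det (M := M) ha hb hε hab hK
  set V := (Matrix.vandermonde fun i => node ε ((0 : PosSignature K).shifted i)).det with hV
  have hV0 : (V : ℂ) ≠ 0 := by exact_mod_cast vandermonde_node_ne_zero hε (0 : PosSignature K)
  -- At `ν = 0` the product of characteristic functions is `1` and only `κ = 0` contributes, so one
  -- regular point determines `Θ`.
  have hΘV : Θ = (V : ℂ)⁻¹ := by
    have hsupp : (Pi.single (0 : PosSignature K) (1 : ℝ) : PosSignature K → ℝ).support = {0} := by
      ext κ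
      simp
    have hreg := isRegularPoint_I_mul (ε := ε) (M := M) (0 : PosSignature (K + M))
      (n := fun j : Fin K => (j : ℕ)) Fin.val_injective
    have h1 := hΘ 0 _ (by rw [hsupp]; exact Set.finite_singleton _)
      (isJacobiExpansion_zero ha hb hε hab) _ hreg
    simp only [hsupp, Set.Finite.toFinset_singleton, Finset.sum_singleton, Pi.single_eq_same] at h1
    rw [Finset.prod_eq_one fun j _ => sigCharFun_zero _ (I_mul_sq_ne_node ε _), one_mul] at h1
    simp only [← hV] at h1
    simp only [PosSignature.zero_shifted] at h1
    obtain ⟨_, h2, h3⟩ := (isRegularPoint_iff _ _).1 hreg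
    have h4 := mul_right_cancel₀ (det_gSq_rev_ne_zero ha hε _ h2 h3) h1
    rw [h4]
    simp
  obtain ⟨_, h2, h3⟩ := (isRegularPoint_iff _ _).1 ht
  have hdet := det_gSq_rev_ne_zero (a := a) ha hε _ h2 h3
  have h1 := hΘ ν c hc h t ht
  rw [hΘV, inv_mul_eq_iff_eq_mul₀ hV0, ← eq_div_iff hdet] at h1
  rw [h1, Finset.mul_sum, Finset.sum_div]
  refine Finset.sum_congr rfl fun κ _ => ?_
  rw [schurG_eq ha, sigDim_eq, ← hV]
  push_cast
  have hκ : ((Matrix.vandermonde fun i => node ε (κ.shifted i)).det : ℂ) ≠ 0 := by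
    exact_mod_cast vandermonde_node_ne_zero hε κ
  field_simp

theorem eq_of_prod_sigCharFun_eq_sum (ha : -1 < a) (hε : 0 ≤ ε) {N : ℕ} (ν : PosSignature N)
    (s : Finset (PosSignature K)) (c d : PosSignature K → ℂ)
    (h : ∀ t : Fin K → ℂ, IsRegularPoint ε (M + 1) ν t →
      ∑ κ ∈ s, c κ / (sigDim ε κ : ℂ) * schurG a ε (M + 1) κ t =
        ∑ κ ∈ s, d κ / (sigDim ε κ : ℂ) * schurG a ε (M + 1) κ t) :
    ∀ κ ∈ s, c κ = d κ := by
  set τ : ℕ → ℂ := fun n => Complex.I * ((n : ℂ) + 1) with hτ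
  have hsep : ∀ R, ∃ p : Fin R → ℕ,
      (Matrix.of fun i j : Fin R => gSq a ε M i (τ (p j) ^ 2)).det ≠ 0 := fun R =>
    ⟨fun j => j, det_gSq_ne_zero ha hε (fun j : Fin R => τ j ^ 2)
      (fun j _ => I_mul_sq_ne_node ε j _) (I_mul_sq_injective.comp Fin.val_injective)⟩
  have hsum : ∀ n : Fin K → ℕ, ∑ κ ∈ s, (c κ - d κ) / (sigDim ε κ : ℂ) *
      (Matrix.of fun i j : Fin K => gSq a ε M (κ.shifted i) (τ (n j) ^ 2)).det = 0 := by
    intro n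
    -- Linear independence is tested on all tuples. For repeated points the hypothesis says nothing,
    -- but then every determinant has two equal columns.
    by_cases hn : Function.Injective n
    · have hreg : IsRegularPoint ε (M + 1) ν fun j => τ (n j) := isRegularPoint_I_mul ν hn
      obtain ⟨_, h2, h3⟩ := (isRegularPoint_iff _ _).1 hreg
      have hdet := det_gSq_rev_ne_zero (a := a) ha hε (fun j => τ (n j) ^ 2) h2 h3
      have h4 := sub_eq_zero.2 (h _ hreg)
      rw [← Finset.sum_sub_distrib] at h4
      simp only [schurG_eq ha, ← sub_mul, ← sub_div, ← mul_div_assoc] at h4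
      rw [← Finset.sum_div, div_eq_zero_iff] at h4
      exact h4.resolve_right hdet
    · rw [Function.Injective] at hn
      push Not at hn
      obtain ⟨i, j, hij, hne⟩ := hn
      refine Finset.sum_eq_zero fun κ _ => ?_
      rw [Matrix.det_zero_of_column_eq hne fun k => by simp [hij], mul_zero]
  have hz := eq_zero_of_sum_det_eq_zero (fun k n => gSq a ε M k (τ n ^ 2)) hsep s
    (fun κ => (c κ - d κ) / (sigDim ε κ : ℂ)) hsum
  intro κ hκ
  have h1 := hz κ hκ
  rw [div_eq_zero_iff] at h1
  exact sub_eq_zero.1 (h1.resolve_right (by exact_mod_cast sigDim_ne_zero hε κ))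

end main

end

/-- Cauchy-type identity for the matrix `Λ^N_K`, with `ε = (a+b+1)/2` and `L = N-K+1`: the row
`Λ^N_K(ν, ·)` is well defined, has finite support, satisfies the identity, and is the only finitely
supported family of coefficients for which the identity holds. -/
theorem theoremA (a b : ℝ) (ha : -1 < a) (hb : -1 < b) (hab : -1 ≤ a + b)
    (N K : ℕ) (hK : 1 ≤ K) (hKN : K < N) (ν : PosSignature N)
    (ε : ℝ) (hε : ε = (a + b + 1) / 2) (L : ℕ) (hL : L = N - K + 1) :
    (∀ c : PosSignature K → ℝ, IsJacobiExpansion a b ν c ↔ c = jacobiLambda a b ν) ∧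
    (jacobiLambda a b ν : PosSignature K → ℝ).support.Finite ∧
    (∀ t : Fin K → ℂ, IsRegularPoint ε L ν t →
      ∏ j, sigCharFun ε ν (t j) =
        ∑ᶠ κ : PosSignature K,
          ((jacobiLambda a b ν κ / sigDim ε κ : ℝ) : ℂ) * schurG a ε L κ t) ∧
    (∀ c : PosSignature K → ℂ, c.support.Finite →
      (∀ t : Fin K → ℂ, IsRegularPoint ε L ν t →
        ∏ j, sigCharFun ε ν (t j) =
          ∑ᶠ κ : PosSignature K, c κ / (sigDim ε κ : ℂ) * schurG a ε L κ t) →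
      ∀ κ, c κ = (jacobiLambda a b ν κ : ℂ)) := by
  classical
  -- `M = N - K` is the number of variables specialized to `1`.
  obtain ⟨M, rfl⟩ := Nat.exists_eq_add_of_le hKN.le
  obtain rfl : L = M + 1 := by omega
  have hε0 : 0 ≤ ε := by rw [hε]; linarith
  have hΛ := isJacobiExpansion_jacobiLambda (K := K) ha hb hε0 hε ν
  have hfin : (jacobiLambda a b ν : PosSignature K → ℝ).support.Finite := hΛ.1
  refine ⟨fun c => ⟨fun h => isJacobiExpansion_unique ha hb hε0 hε ν h hΛ, fun h => h ▸ hΛ⟩,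
    hfin, fun t ht => ?_, fun c hc h => ?_⟩
  · rw [prod_sigCharFun_eq_sum ha hb hε0 hε hK ν hfin hΛ ht]
    refine (finsum_eq_sum_of_support_subset _ fun κ hκ => ?_).symm
    rw [hfin.coe_toFinset, Function.mem_support]
    intro h0
    exact hκ (by simp [h0])
  · have hc0 : ∀ κ ∉ hc.toFinset, c κ = 0 := fun κ hκ => by simpa using hκ
    have hd0 : ∀ κ ∉ hfin.toFinset, jacobiLambda a b ν κ = 0 := fun κ hκ => by simpa using hκ
    -- The two supports may differ a priori, so both sums are extended by zero to their union.
    have key := eq_of_prod_sigCharFun_eq_sum ha hε0 ν (hc.toFinset ∪ hfin.toFinset) c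
      (fun κ => (jacobiLambda a b ν κ : ℂ)) (M := M) (by
        intro t ht
        have h1 := prod_sigCharFun_eq_sum ha hb hε0 hε hK ν hfin hΛ ht
        rw [h t ht, finsum_eq_sum_of_support_subset (s := hc.toFinset ∪ hfin.toFinset) _
          (fun κ hκ => by
            rw [Finset.mem_coe, Finset.mem_union]
            left
            by_contra h0
            exact hκ (by simp [hc0 κ h0]))] at h1
        rw [h1]
        push_cast
        exact Finset.sum_subset Finset.subset_union_right fun κ _ hκ => by simp [hd0 κ hκ])
    intro κ
    by_cases hκ : κ ∈ hc.toFinset ∪ hfin.toFinset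
    · exact key κ hκ
    · rw [Finset.mem_union, not_or] at hκ
      rw [hc0 κ hκ.1, hd0 κ hκ.2, Complex.ofReal_zero]
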